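/- Work over $\mathbb C$ and fix $d\in\mathbb N$. Let $M=H^0(\mathcal O_{\mathbb P^1}(d))^{\oplus 5}\cong\mathbb C^{5d+5}$, and let $M_d\subset M$ be the set of those $c$ that define a morphism $c:\mathbb P^1\to\mathbb P^4$ which is birational onto its image and whose push-forward cycle has degree $d$. Let $S=\mathbb P(H^0(\mathcal O_{\mathbb P^4}(5)))$. There is a nonempty Zariski open subset of $S$, depending only on $d$, such that the following holds for every $[f_0]$ in it, with $X_0=\operatorname{div}(f_0)$. Let $f_2$ be a quintic form with $[f_2]\ne[f_0]$, and let $\mathbb L_2\ni[f_0]$ be a (Euclidean) open subset of the pencil spanned by $[f_0]$ and $[f_2]$. Let $I_{f_0}$ be an irreducible component of the scheme $\{c\in M_d: c^*(f_0)=0\}$, let $\Gamma_{\mathbb L_2}$ be an irreducible component of $\{(c,[f])\in M_d\times\mathbb L_2: c^*(f)=0\}$, and let $I_{\mathbb L_2}\subset M_d$ be its projection. Assume that $I_{f_0}\subset I_{\mathbb L_2}$ and that $c_0^*(f_2)\neq 0$ for generic $c_0\in I_{f_0}$. Tangent spaces are Zariski tangent spaces of the incidence schemes: $T_{c_0}I_{f_0}$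 is that of the scheme defined by the vanishing of the coefficients of $c^*(f_0)$; $T_{(c_0,[f_0])}\Gamma_{\mathbb L_2}$ is that of the scheme of pairs $(c,[f])$ defined by the vanishing of the coefficients of $c^*(f)$; and $T_{c_0}I_{\mathbb L_2}$ is that of the scheme defined by the $2\times 2$ minors of the coefficients of $c^*(f_0)$ and $c^*(f_2)$. Then for generic $c_0\in I_{f_0}$ (that is, for all $c_0$ outside a proper Zariski closed subset of $I_{f_0}$): (a) The map that sends $\alpha\in T_{c_0}I_{f_0}$ to the section of $c_0^*T_{X_0}$ given by the corresponding first-order deformation of $c_0$ has a kernel $\ker$ of dimension $1$ and induces an isomorphism $T_{c_0}I_{f_0}/\ker\;\simeq\;H^0(c_0^*T_{X_0})$. (b) $\dim T_{(c_0,[f_0])}\Gamma_{\mathbb L_2}=\dim T_{c_0}I_{f_0}+1$ and $\dim T_{c_0}I_{\mathbb L_2}=\dim T_{c_0}I_{f_0}+1$. (c) If $\dim T_{c_0}I_{\mathbb L_2}=5$, then $c_0$ is an immersion and $H^1(N_{c_0/X_0})=0$, where $N_{c_0/X_0}$ is the cokernel of $(c_0)_*:T_{\mathbb P^1}\to c_0^*T_{X_0}$.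 -/

import Mathlib

open MvPolynomial Topology
open scoped LaurentPolynomial LinearAlgebra.Projectivization

noncomputable section

namespace QuinticCurves

/-! ### Parametrized curves of degree `d` in `ℙ⁴` -/

/-- Coordinates of the space `M = H⁰(𝒪_{ℙ¹}(d))^{⊕5} ≃ ℂ^{5d+5}`. -/
abbrev Idx (d : ℕ) : Type := Fin 5 × Fin (d + 1)

/-- The affine space `M` of 5-tuples of binary forms of degree `d`, given by their coefficients.
Its tangent space at each point is `M d` itself. -/
abbrev M (d : ℕ) : Type := Idx d → ℂ

/-- The `i`-th component of the tuple `c`: the form `∑ⱼ cᵢⱼ x₀^{d-j} x₁^j`. -/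
def form {d : ℕ} (c : M d) (i : Fin 5) : MvPolynomial (Fin 2) ℂ :=
  ∑ j : Fin (d + 1), C (c (i, j)) * X 0 ^ (d - (j : ℕ)) * X 1 ^ (j : ℕ)

/-- The pull-back `c^*(f) = f(c)`, a binary form. -/
def pull {d : ℕ} (c : M d) (f : MvPolynomial (Fin 5) ℂ) : MvPolynomial (Fin 2) ℂ :=
  aeval (form c) f

/-- The components of `c` have no common zero on `ℙ¹`. -/
def IsBasePointFree {d : ℕ} (c : M d) : Prop :=
  ∀ p : Fin 2 → ℂ, p ≠ 0 → ∃ i, eval p (form c i) ≠ 0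

/-- The map given by `c` is birational onto its image: it has a rational inverse `[G₀ : G₁]`,
where `G₀, G₁` are forms of the same degree in five variables, not both zero on the image. -/
def IsBirationalOntoImage {d : ℕ} (c : M d) : Prop :=
  ∃ (e : ℕ) (G : Fin 2 → MvPolynomial (Fin 5) ℂ), (∀ k, (G k).IsHomogeneous e) ∧
    (∃ k, pull c (G k) ≠ 0) ∧ pull c (G 0) * X 1 = pull c (G 1) * X 0

/-- `M_d`: the tuples that define maps `ℙ¹ → ℙ⁴` birational onto the image with push-forward cycle
of degree `d` (so the forms have no common zero, which would lower the degree). -/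
def Md (d : ℕ) : Set (M d) := {c | IsBasePointFree c ∧ IsBirationalOntoImage c}

/-- `c` is an immersion: at every point `[p] ∈ ℙ¹` the differential
`T_{[p]}ℙ¹ = Hom(ℂp, ℂ²/ℂp) → T_{[c(p)]}ℙ⁴ = Hom(ℂc(p), ℂ⁵/ℂc(p))`, `w ↦ dc_p(w)`,
is injective, and `c` is an isomorphism onto its image on some nonempty open set. -/
def IsImmersion {d : ℕ} (c : M d) : Prop :=
  (∀ p : Fin 2 → ℂ, p ≠ 0 → ∀ w : Fin 2 → ℂ,
    (fun i => ∑ k, eval p (pderiv k (form c i)) * w k) ∈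
      Submodule.span ℂ {fun i => eval p (form c i)} →
    w ∈ Submodule.span ℂ {p}) ∧
  IsBirationalOntoImage c

/-! ### Irreducible components and genericity -/

/-- `Z` is irreducible with respect to a family of closed sets. -/
def IsIrred {E : Type} (closed : Set (Set E)) (Z : Set E) : Prop :=
  Z.Nonempty ∧ ∀ Z₁ ∈ closed, ∀ Z₂ ∈ closed, Z ⊆ Z₁ ∪ Z₂ → Z ⊆ Z₁ ∨ Z ⊆ Z₂

/-- An irreducible component: a maximal irreducible closed set. -/
def IsIrredComponent {E : Type} (closed : Set (Set E)) (Z : Set E) : Prop :=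
  Maximal (fun Y => Y ∈ closed ∧ IsIrred closed Y) Z

/-- The Zariski closed subsets of a subset `A` of affine space. -/
def algebraicSubsets {σ : Type} (A : Set (σ → ℂ)) : Set (Set (σ → ℂ)) :=
  {Z | ∃ P : Set (MvPolynomial σ ℂ), Z = {x ∈ A | ∀ p ∈ P, eval x p = 0}}

/-- The closed complex analytic subsets of `A`: near each point of `A` they are cut out in `A` by
finitely many holomorphic functions. -/
def analyticSubsets {E : Type} [NormedAddCommGroup E] [NormedSpace ℂ E] (A : Set E) :
    Set (Set E) :=
  {Z | Z ⊆ A ∧ ∀ x ∈ A, ∃ V : Set E, IsOpen V ∧ x ∈ V ∧ ∃ G : Set (E → ℂ), G.Finite ∧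
    (∀ g ∈ G, AnalyticOnNhd ℂ g V) ∧ Z ∩ V = {y ∈ A ∩ V | ∀ g ∈ G, g y = 0}}

/-- `P` holds at a generic point of the irreducible set `Z`, that is, off a proper Zariski closed
subset of `Z`. -/
def ForGenericPoint {σ : Type} (Z : Set (σ → ℂ)) (P : (σ → ℂ) → Prop) : Prop :=
  ∃ q : MvPolynomial σ ℂ, (∃ x ∈ Z, eval x q ≠ 0) ∧ ∀ x ∈ Z, eval x q ≠ 0 → P x

/-- `P` holds for a generic quintic: off a proper Zariski closed subset of
`S = ℙ(H⁰(𝒪_{ℙ⁴}(5)))`, whose homogeneous coordinates are the coefficients of the quintic. -/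
def ForGenericQuintic (P : MvPolynomial (Fin 5) ℂ → Prop) : Prop :=
  ∃ (n : ℕ) (Q : MvPolynomial {m : Fin 5 →₀ ℕ // m.degree = 5} ℂ), Q.IsHomogeneous n ∧ Q ≠ 0 ∧
    ∀ f : MvPolynomial (Fin 5) ℂ, f.IsHomogeneous 5 → f ≠ 0 →
      eval (fun m : {m : Fin 5 →₀ ℕ // m.degree = 5} => coeff m.1 f) Q ≠ 0 → P f

/-! ### Incidence sets -/

/-- The points of the incidence scheme `{c ∈ M_d : c^*(f) = 0}`. -/
def incidence (d : ℕ) (f : MvPolynomial (Fin 5) ℂ) : Set (M d) :=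
  {c ∈ Md d | pull c f = 0}

/-- The affine cone over a subset of the pencil spanned by two quintics, the point `[w₀ : w₁]`
being the quintic `w₀ f₀ + w₁ f₂`. -/
def cone (L : Set (ℙ ℂ (Fin 2 → ℂ))) : Set (Fin 2 → ℂ) :=
  {w | ∃ hw : w ≠ 0, Projectivization.mk ℂ w hw ∈ L}

/-- The point `[1 : 0]` of the pencil, that is, `[f₀]`. -/
def basePt : ℙ ℂ (Fin 2 → ℂ) := Projectivization.mk ℂ ![1, 0] (fun h => by simpa using congrFun h 0)

/-- The points of `{(c, [f]) ∈ M_d × L : c^*(f) = 0}` for a subset `L` of the pencil of `f₀, f₂`,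
with `[f] = [w₀ f₀ + w₁ f₂]` represented by all nonzero vectors `w` on its line. Taking inverse
images identifies the irreducible components over `L` with those of this cone. -/
def incidenceOver (d : ℕ) (f₀ f₂ : MvPolynomial (Fin 5) ℂ) (L : Set (ℙ ℂ (Fin 2 → ℂ))) :
    Set (M d × (Fin 2 → ℂ)) :=
  {x | x.1 ∈ Md d ∧ x.2 ∈ cone L ∧ pull x.1 (C (x.2 0) * f₀ + C (x.2 1) * f₂) = 0}

/-! ### Incidence schemes and their Zariski tangent spaces -/

/-- The Zariski tangent space, at a point `p`, of the subscheme of affine space defined by an ideal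
that vanishes at `p`. -/
def zariskiTangent {σ : Type} [Fintype σ] (I : Ideal (MvPolynomial σ ℂ)) (p : σ → ℂ) :
    Submodule ℂ (σ → ℂ) where
  carrier := {α | ∀ g ∈ I, ∑ k, α k * eval p (pderiv k g) = 0}
  zero_mem' := by intro g _; simp
  add_mem' := by
    intro α β hα hβ g hg
    simp only [Pi.add_apply, add_mul, Finset.sum_add_distrib, hα g hg, hβ g hg, add_zero]
  smul_mem' := by
    intro r α hα g hg
    simp only [Pi.smul_apply, smul_eq_mul, mul_assoc, ← Finset.mul_sum, hα g hg, mul_zero]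

/-- The universal tuple of binary forms, with coefficients in the coordinate ring of `M`. -/
def univForm (d : ℕ) (i : Fin 5) : MvPolynomial (Fin 2) (MvPolynomial (Idx d) ℂ) :=
  ∑ j : Fin (d + 1), C (X (i, j)) * X 0 ^ (d - (j : ℕ)) * X 1 ^ (j : ℕ)

/-- The coefficients of the binary form `c^*(f)`, as polynomials in the coordinates of `c`. -/
def pullCoeff (d : ℕ) (f : MvPolynomial (Fin 5) ℂ) (m : Fin 2 →₀ ℕ) : MvPolynomial (Idx d) ℂ :=
  coeff m (aeval (univForm d) f : MvPolynomial (Fin 2) (MvPolynomial (Idx d) ℂ))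

/-- The ideal of the scheme `{c : c^*(f) = 0}`. -/
def incidenceIdeal (d : ℕ) (f : MvPolynomial (Fin 5) ℂ) : Ideal (MvPolynomial (Idx d) ℂ) :=
  Ideal.span (Set.range (pullCoeff d f))

/-- The ideal of the scheme `{(c, u) : c^*(f₀ + u f₂) = 0}`, the incidence scheme over the affine
chart `u ↦ [f₀ + u f₂]` of the pencil at `[f₀]`; `X none` is the coordinate `u`. -/
def pencilIncidenceIdeal (d : ℕ) (f₀ f₂ : MvPolynomial (Fin 5) ℂ) :
    Ideal (MvPolynomial (Option (Idx d)) ℂ) :=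
  Ideal.span (Set.range fun m : Fin 2 →₀ ℕ =>
    rename some (pullCoeff d f₀ m) + X none * rename some (pullCoeff d f₂ m))

/-- The ideal of the projected incidence scheme `{c : c^*(f) = 0 for some f in the pencil}`:
the two binary forms `c^*(f₀)`, `c^*(f₂)` are linearly dependent, so the `2 × 2` minors of their
coefficients vanish. -/
def projectedIdeal (d : ℕ) (f₀ f₂ : MvPolynomial (Fin 5) ℂ) : Ideal (MvPolynomial (Idx d) ℂ) :=
  Ideal.span {g | ∃ m n : Fin 2 →₀ ℕ,
    g = pullCoeff d f₀ m * pullCoeff d f₂ n - pullCoeff d f₀ n * pullCoeff d f₂ m}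

/-- `T_{c₀} I_{f₀}`. -/
abbrev tangentI {d : ℕ} (f₀ : MvPolynomial (Fin 5) ℂ) (c₀ : M d) : Submodule ℂ (M d) :=
  zariskiTangent (incidenceIdeal d f₀) c₀

/-- `T_{(c₀, [f₀])} Γ_{𝕃₂}`; the point `(c₀, [f₀])` is `(c₀, u = 0)`. -/
abbrev tangentGammaPencil {d : ℕ} (f₀ f₂ : MvPolynomial (Fin 5) ℂ) (c₀ : M d) :
    Submodule ℂ (Option (Idx d) → ℂ) :=
  zariskiTangent (pencilIncidenceIdeal d f₀ f₂) (fun k => k.elim 0 c₀)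

/-- `T_{c₀} I_{𝕃₂}`. -/
abbrev tangentIPencil {d : ℕ} (f₀ f₂ : MvPolynomial (Fin 5) ℂ) (c₀ : M d) : Submodule ℂ (M d) :=
  zariskiTangent (projectedIdeal d f₀ f₂) c₀

/-! ### Coherent sheaves on `ℙ¹` and their Čech cohomology

The projective line has the affine cover by `{x₀ ≠ 0} = Spec ℂ[z]` and
`{x₁ ≠ 0} = Spec ℂ[z⁻¹]`, where `z = x₁ / x₀`; the overlap is `Spec ℂ[z, z⁻¹]`. -/

/-- The two standard charts and their overlap. -/
inductive Chart : Type
  | zero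
  | one
  | overlap

/-- Sections of `𝒪(n)` over a chart. A section `F`, homogeneous of degree `n` in `x₀, x₁`, is
written as the Laurent polynomial `F(1, z)`; over `{x₁ ≠ 0}` these are the elements of
`zⁿ ℂ[z⁻¹]`. -/
def twist (n : ℕ) : Chart → Submodule ℂ ℂ[T;T⁻¹]
  | .zero => Subalgebra.toSubmodule (Algebra.adjoin ℂ {LaurentPolynomial.T 1})
  | .one => (Subalgebra.toSubmodule (Algebra.adjoin ℂ {LaurentPolynomial.T (-1)})).map
      (LinearMap.mulLeft ℂ (LaurentPolynomial.T (n : ℤ)))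
  | .overlap => ⊤

/-- A sheaf on `ℙ¹` that over each chart is the quotient of a module of sections `num` by the
sections that lie in `den`; restriction is induced by the identity of the ambient space `V`. -/
structure SubquotientSheaf (V : Type) [AddCommGroup V] [Module ℂ V] where
  num : Chart → Submodule ℂ V
  den : Chart → Submodule ℂ V
  num_le : ∀ U, num U ≤ num .overlap
  den_le : ∀ U, den U ≤ den .overlap

namespace SubquotientSheaf

variable {V : Type} [AddCommGroup V] [Module ℂ V] (F : SubquotientSheaf V)

/-- Sections over a chart. -/
abbrev sections (U : Chart) : Type := F.num U ⧸ (F.den U).comap (F.num U).subtype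

/-- The class of a section. -/
def cls (U : Chart) (v : V) (hv : v ∈ F.num U) : F.sections U :=
  Submodule.Quotient.mk ⟨v, hv⟩

/-- Restriction to the overlap. -/
def res (U : Chart) : F.sections U →ₗ[ℂ] F.sections .overlap :=
  Submodule.mapQ _ _ (Submodule.inclusion (F.num_le U)) (fun _ hx => F.den_le U hx)

/-- `H⁰`: pairs of sections over the two charts that agree on the overlap. -/
abbrev H0 : Submodule ℂ (F.sections .zero × F.sections .one) :=
  LinearMap.ker (F.res .zero ∘ₗ LinearMap.fst ℂ _ _ - F.res .one ∘ₗ LinearMap.snd ℂ _ _)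

/-- `H¹`: sections over the overlap modulo differences of sections over the two charts. -/
abbrev H1 : Type :=
  F.sections .overlap ⧸ (LinearMap.range (F.res .zero) ⊔ LinearMap.range (F.res .one))

end SubquotientSheaf

/-- The Laurent polynomial `F(1, z)`. -/
def dehom : MvPolynomial (Fin 2) ℂ →ₐ[ℂ] ℂ[T;T⁻¹] := aeval ![1, LaurentPolynomial.T 1]

/-- Multiplication of a scalar with a fixed vector. -/
def scale (v : Fin 5 → ℂ[T;T⁻¹]) : ℂ[T;T⁻¹] →ₗ[ℂ] (Fin 5 → ℂ[T;T⁻¹]) :=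
  (LinearMap.toSpanSingleton ℂ[T;T⁻¹] (Fin 5 → ℂ[T;T⁻¹]) v).restrictScalars ℂ

/-- The 5-tuple `c`, as a section of `𝒪(d)^{⊕5}`. -/
def vec {d : ℕ} (c : M d) (i : Fin 5) : ℂ[T;T⁻¹] := dehom (form c i)

/-- The partial derivative `∂c/∂x_k`, as a section of `𝒪(d-1)^{⊕5}`. -/
def dvec {d : ℕ} (c : M d) (k : Fin 2) (i : Fin 5) : ℂ[T;T⁻¹] := dehom (pderiv k (form c i))

/-- Sections over `U` of the kernel of `𝒪(d)^{⊕5} → 𝒪(5d)`, `w ↦ ∑ᵢ (∂f/∂zᵢ)(c) wᵢ`. -/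
def kernelSections {d : ℕ} (f : MvPolynomial (Fin 5) ℂ) (c : M d) (U : Chart) :
    Submodule ℂ (Fin 5 → ℂ[T;T⁻¹]) where
  carrier := {w | (∀ i, w i ∈ twist d U) ∧ ∑ i, dehom (pull c (pderiv i f)) * w i = 0}
  zero_mem' := ⟨fun _ => Submodule.zero_mem _, by simp⟩
  add_mem' := by
    rintro v w ⟨hv, hv'⟩ ⟨hw, hw'⟩
    refine ⟨fun i => Submodule.add_mem _ (hv i) (hw i), ?_⟩
    simp only [Pi.add_apply, mul_add, Finset.sum_add_distrib, hv', hw', add_zero]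
  smul_mem' := by
    rintro r w ⟨hw, hw'⟩
    refine ⟨fun i => Submodule.smul_mem _ r (hw i), ?_⟩
    simp only [Pi.smul_apply, mul_smul_comm, ← Finset.smul_sum, hw', smul_zero]

theorem twist_le (n : ℕ) (U : Chart) : twist n U ≤ twist n .overlap := fun _ _ => trivial

theorem kernelSections_le {d : ℕ} (f : MvPolynomial (Fin 5) ℂ) (c : M d) (U : Chart) :
    kernelSections f c U ≤ kernelSections f c .overlap :=
  fun _ hw => ⟨fun _ => trivial, hw.2⟩

/-- The sheaf `c^*(T_X)` for `X = div(f)` and a curve `c` on `X`. By the Euler sequence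
`0 → 𝒪 → 𝒪(d)^{⊕5} → c^*T_{ℙ⁴} → 0`, whose first map is `a ↦ a c`, and the sequence
`0 → c^*T_X → c^*T_{ℙ⁴} → 𝒪(5d)`, it is the quotient by `𝒪 c` of the kernel of `df(c)` on
`𝒪(d)^{⊕5}`. -/
def pullTangent {d : ℕ} (f : MvPolynomial (Fin 5) ℂ) (c : M d) :
    SubquotientSheaf (Fin 5 → ℂ[T;T⁻¹]) where
  num := kernelSections f c
  den U := (twist 0 U).map (scale (vec c))
  num_le := kernelSections_le f c
  den_le U := Submodule.map_mono (twist_le 0 U)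

/-- The normal sheaf `N_{c/X}`, the cokernel of `c_* : T_{ℙ¹} → c^*(T_X)`. Here
`T_{ℙ¹} = 𝒪(1)^{⊕2} / 𝒪` by the Euler sequence, and `c_*` is `(a, b) ↦ a ∂c/∂x₀ + b ∂c/∂x₁`. -/
def normalSheaf {d : ℕ} (f : MvPolynomial (Fin 5) ℂ) (c : M d) :
    SubquotientSheaf (Fin 5 → ℂ[T;T⁻¹]) where
  num := kernelSections f c
  den U := (twist 0 U).map (scale (vec c)) ⊔
    ((twist 1 U).map (scale (dvec c 0)) ⊔ (twist 1 U).map (scale (dvec c 1)))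
  num_le := kernelSections_le f c
  den_le U := sup_le_sup (Submodule.map_mono (twist_le 0 U))
    (sup_le_sup (Submodule.map_mono (twist_le 1 U)) (Submodule.map_mono (twist_le 1 U)))

/-- `s ∈ H⁰(c^*T_X)` is the section that the first order deformation `α ∈ T_c M` of `c` induces
(the image of `α` under the differential of the evaluation map `(c, t) ↦ c(t)`): over both charts
it is the class of the tuple `α`. -/
def IsInducedSection {d : ℕ} (f : MvPolynomial (Fin 5) ℂ) (c α : M d)
    (s : (pullTangent f c).H0) : Prop :=
  ∃ (h₀ : vec α ∈ (pullTangent f c).num .zero) (h₁ : vec α ∈ (pullTangent f c).num .one),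
    s.1 = ((pullTangent f c).cls .zero (vec α) h₀, (pullTangent f c).cls .one (vec α) h₁)

end QuinticCurves

end

/-!
For `c` in the affine space `M d`, write `df(c) · α = ∑ᵢ (∂ᵢf)(c) αᵢ` for the differential of
`c ↦ c^*(f)`; it is `dpull f c` below, a map from `M d` to binary forms of degree `5d`. On the
incidence set, `T_c I_f` is its kernel.

The genericity of `f₀` enters through generic smoothness. Applied to the universal incidence scheme
`{(c, f) : c^*(f) = 0}` over the space of quintics, it says that for generic `f₀` every first order
deformation of `f₀` lifts to each curve `c` on it, so that `c^*(f₂)` lies in the image of `df₀(c)` for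
*every* quintic `f₂` (`DeformsWith`, `forGenericQuintic_deformsWith`). The version of generic
smoothness needed, `exists_lift_over_generic`, is proved by Noetherian induction from the fact that
derivations extend to finitely generated field extensions in characteristic zero.

* (b) If `c^*(f₂) ≠ 0`, then `T_c I_{𝕃₂}` is the set of `α` with `df₀(c) · α ∈ ℂ c^*(f₂)`, and
  the tangent space of the incidence scheme over the pencil projects isomorphically onto it. As
  `c^*(f₂)` is in the image of `df₀(c)`, the dimension is that of the kernel plus one.
* (a) `T_c I_f` is the space of global sections of the kernel `K` of
  `df(c) : 𝒪(d)^{⊕5} → 𝒪(5d)`, and `c^*T_X` is the quotient of `K` by `𝒪 c`. Since `H¹(𝒪) = 0`, the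
  induced map on global sections is onto, with kernel `H⁰(𝒪) c = ℂ c`
  (`exists_quotient_equiv_H0`).
* (c) Now the kernel of `df₀(c)` has dimension `4`, so by counting `df₀(c)` is onto the binary forms
  of degree `5d`. Hence `H¹(K) = 0`, and so `H¹(N) = 0` for its quotient `N`
  (`subsingleton_H1_normalSheaf`). If `c` were not an immersion at `p`, then some derivative `∂_w c`
  would vanish at `p`, hence be `l g` with `l` a linear form. Then all `A g + B ∂_p c` with `A`
  quadratic and `B` linear are in the kernel of `df₀(c)`; they form a space of dimension `5`, because
  a relation would make `g` proportional to `c`, which has larger degree and no common zero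
  (`five_le_finrank_ker_dpull`).
-/

/-! ### Generic lifting of tangent vectors -/

/-- In characteristic zero, a derivation of a finitely generated field extension may be prescribed
freely on algebraically independent elements `a`. The extension is formally smooth over `k[a]`, so
`K ⊗ Ω[k[a]/k] → Ω[K/k]` is injective and the prescribed functional on the left extends to the
right. -/
theorem Derivation.exists_apply_eq_of_algebraicIndependent {k K τ : Type} [Field k] [CharZero k]
    [Field K] [Algebra k K] [Algebra.EssFiniteType k K] {a : τ → K}
    (ha : AlgebraicIndependent k a) (b : τ → K) :
    ∃ D : Derivation k K K, ∀ t, D (a t) = b t := by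
  let A := MvPolynomial τ k
  let : Algebra A K := (aeval (R := k) a).toAlgebra
  have hmap : ∀ x : A, algebraMap A K x = aeval a x := fun _ => rfl
  have : IsScalarTower k A K := .of_algebraMap_eq fun r => by rw [hmap, algebraMap_eq, aeval_C]
  have : FaithfulSMul A K := (faithfulSMul_iff_algebraMap_injective A K).2 ha
  let : Algebra (FractionRing A) K := FractionRing.liftAlgebra A K
  have : IsScalarTower A (FractionRing A) K := FractionRing.isScalarTower_liftAlgebra A K
  have : IsScalarTower k (FractionRing A) K := .of_algebraMap_eq fun r => by
    rw [IsScalarTower.algebraMap_apply k A K, IsScalarTower.algebraMap_apply k A (FractionRing A),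
      ← IsScalarTower.algebraMap_apply A (FractionRing A) K]
  have : Algebra.EssFiniteType (FractionRing A) K := .of_comp k _ _
  have : CharZero (FractionRing A) := charZero_of_injective_algebraMap
    (algebraMap k (FractionRing A)).injective
  have : Algebra.FormallySmooth A (FractionRing A) := .of_isLocalization (nonZeroDivisors A)
  have : Algebra.FormallySmooth A K := .comp A (FractionRing A) K
  have hinj : LinearMap.ker (KaehlerDifferential.mapBaseChange k A K) = ⊥ := by
    rw [LinearMap.ker_eq_bot, injective_iff_map_eq_zero]
    intro x hx
    obtain ⟨y, rfl⟩ := (Algebra.H1Cotangent.exact_δ_mapBaseChange k A K x).mp hx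
    rw [Subsingleton.elim y 0, map_zero]
  obtain ⟨g, hg⟩ := LinearMap.exists_leftInverse_of_injective _ hinj
  let D₀ : Derivation k A K := mkDerivation k b
  let φ : TensorProduct A K (Ω[A⁄k]) →ₗ[K] K := D₀.liftKaehlerDifferential.liftBaseChange K
  refine ⟨(KaehlerDifferential.linearMapEquivDerivation k K) (φ ∘ₗ g), fun t => ?_⟩
  have h1 : KaehlerDifferential.D k K (a t) =
      KaehlerDifferential.mapBaseChange k A K (1 ⊗ₜ KaehlerDifferential.D k A (X t)) := by
    simp [hmap]
  have h2 := LinearMap.congr_fun hg (1 ⊗ₜ KaehlerDifferential.D k A (X t))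
  rw [LinearMap.comp_apply, LinearMap.id_apply, ← h1] at h2
  change φ (g (KaehlerDifferential.D k K (a t))) = b t
  rw [h2]
  have h3 : D₀ (X t) = b t := mkDerivation_X k b t
  simp [φ, h3]

/-- The chain rule for a derivation and polynomials in several variables. -/
theorem Derivation.apply_aeval {k A N σ : Type*} [CommRing k] [CommRing A] [Algebra k A]
    [AddCommGroup N] [Module A N] [Module k N] [IsScalarTower k A N] [Fintype σ]
    (D : Derivation k A N) (x : σ → A) (g : MvPolynomial σ k) :
    D (aeval x g) = ∑ i, aeval x (pderiv i g) • D (x i) := by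
  classical
  induction g using MvPolynomial.induction_on with
  | C r => simp
  | add p q hp hq => simp [hp, hq, add_smul, Finset.sum_add_distrib]
  | mul_X p i hp =>
    simp only [map_mul, aeval_X, Derivation.leibniz, hp, pderiv_X, smul_eq_mul, map_add,
      add_smul, Finset.sum_add_distrib, Finset.smul_sum, smul_smul]
    congr 1
    simp [Pi.single_apply, ite_smul]

/-- Let the integral variety `V(P)` dominate the affine space with coordinates `τ`. Off a
hypersurface, the coordinate vector field `∂/∂t` of the base lifts to tangent vectors of `V(P)`:
extend `∂/∂t` to a derivation of the function field of `V(P)` and clear denominators. -/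
theorem exists_lift_off_of_isPrime {σ τ : Type} [Fintype σ] [Fintype τ]
    (P : Ideal (MvPolynomial (σ ⊕ τ) ℂ)) [P.IsPrime]
    (hP : ∀ Q : MvPolynomial τ ℂ, rename Sum.inr Q ∈ P → Q = 0) (t : τ) :
    ∃ h ∉ P, ∀ y : σ ⊕ τ → ℂ, (∀ g ∈ P, eval y g = 0) → eval y h ≠ 0 →
      ∃ v : σ → ℂ, ∀ g ∈ P,
        ∑ k, v k * eval y (pderiv (Sum.inl k) g) + eval y (pderiv (Sum.inr t) g) = 0 := by
  classical
  let R := MvPolynomial (σ ⊕ τ) ℂ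
  let K := FractionRing (R ⧸ P)
  have : Algebra.EssFiniteType (R ⧸ P) K := .of_isLocalization _ (nonZeroDivisors (R ⧸ P))
  have : Algebra.EssFiniteType ℂ K := .comp ℂ (R ⧸ P) K
  let x : σ ⊕ τ → K := fun i => algebraMap (R ⧸ P) K (Ideal.Quotient.mk P (X i))
  have hx : ∀ g : R, aeval x g = algebraMap (R ⧸ P) K (Ideal.Quotient.mk P g) := by
    intro g
    have : (aeval x : R →ₐ[ℂ] K) =
        (IsScalarTower.toAlgHom ℂ (R ⧸ P) K).comp (Ideal.Quotient.mkₐ ℂ P) := by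
      ext i; simp [x]
    rw [this]; simp
  have hx0 : ∀ g : R, aeval x g = 0 ↔ g ∈ P := by
    intro g
    rw [hx, map_eq_zero_iff _ (IsFractionRing.injective (R ⧸ P) K), Ideal.Quotient.eq_zero_iff_mem]
  have ha : AlgebraicIndependent ℂ (fun s => x (Sum.inr s)) := by
    rw [algebraicIndependent_iff]
    intro Q hQ
    refine hP Q ((hx0 _).1 ?_)
    rw [aeval_rename]; exact hQ
  obtain ⟨D, hD⟩ := Derivation.exists_apply_eq_of_algebraicIndependent ha (Pi.single t 1)
  obtain ⟨b, hb⟩ := IsLocalization.exist_integer_multiples_of_finite (nonZeroDivisors (R ⧸ P))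
    (fun k : σ => D (x (Sum.inl k)))
  choose c hc using hb
  obtain ⟨h, hh⟩ := Ideal.Quotient.mk_surjective (b : R ⧸ P)
  choose p hp using fun k => Ideal.Quotient.mk_surjective (c k)
  refine ⟨h, fun hmem => nonZeroDivisors.coe_ne_zero b ?_, fun y hy hyh => ?_⟩
  · rw [← hh, Ideal.Quotient.eq_zero_iff_mem.2 hmem]
  refine ⟨fun k => eval y (p k) / eval y h, fun g hg => ?_⟩
  have h1 : ∑ k, p k * pderiv (Sum.inl k) g + h * pderiv (Sum.inr t) g ∈ P := by
    have h2 := D.apply_aeval x g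
    rw [(hx0 g).2 hg, map_zero, Fintype.sum_sum_type] at h2
    simp only [hD, smul_eq_mul, Pi.single_apply, mul_ite, mul_one, mul_zero, Finset.sum_ite_eq',
      Finset.mem_univ, if_true] at h2
    rw [← hx0, map_add, map_sum, ← mul_zero (aeval x h), h2, mul_add, Finset.mul_sum, map_mul]
    congr 1
    refine Finset.sum_congr rfl fun k _ => ?_
    have h3 := hc k
    rw [Algebra.smul_def] at h3
    rw [map_mul, hx (p k), hp, h3, hx h, hh]
    ring
  have h4 := hy _ h1
  simp only [map_add, map_sum, map_mul] at h4
  field_simp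
  rw [← Finset.sum_div, eq_neg_of_add_eq_zero_left h4]
  field_simp
  ring

/-- Generic smoothness in the form needed here: for an affine scheme `V(I)` over the affine space
with coordinates `τ`, there is a hypersurface `Q = 0` of the base such that at *every* closed point of
`V(I)` off that hypersurface, the base vector `∂/∂t` lifts to a Zariski tangent vector of `V(I)`.
The proof is by Noetherian induction: an integral `V(I)` that dominates the base is treated away from
a proper closed subset, one that does not dominate lies over a hypersurface, and the others
are unions of two proper closed subsets. -/
theorem exists_lift_over_generic {σ τ : Type} [Fintype σ] [Fintype τ]
    (I : Ideal (MvPolynomial (σ ⊕ τ) ℂ)) (t : τ) :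
    ∃ Q : MvPolynomial τ ℂ, Q ≠ 0 ∧ ∀ y : σ ⊕ τ → ℂ, (∀ g ∈ I, eval y g = 0) →
      eval (fun s => y (Sum.inr s)) Q ≠ 0 →
      ∃ v : σ → ℂ, ∀ g ∈ I,
        ∑ k, v k * eval y (pderiv (Sum.inl k) g) + eval y (pderiv (Sum.inr t) g) = 0 := by
  induction I using WellFoundedGT.induction with
  | ind I ih =>
  -- the induction hypothesis takes care of the points of `V(I)` on a hypersurface `h = 0`
  have key : ∀ h ∉ I,
      ∃ Q : MvPolynomial τ ℂ, Q ≠ 0 ∧ ∀ y : σ ⊕ τ → ℂ, (∀ g ∈ I, eval y g = 0) →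
      eval y h = 0 → eval (fun s => y (Sum.inr s)) Q ≠ 0 →
      ∃ v : σ → ℂ, ∀ g ∈ I,
        ∑ k, v k * eval y (pderiv (Sum.inl k) g) + eval y (pderiv (Sum.inr t) g) = 0 := by
    intro h hh
    obtain ⟨Q, hQ, H⟩ := ih (I ⊔ Ideal.span {h})
      (lt_of_le_of_ne le_sup_left fun e => hh (e.symm.le
        (Ideal.mem_sup_right (Ideal.mem_span_singleton_self h))))
    refine ⟨Q, hQ, fun y hy hyh hyQ => ?_⟩
    have hle : I ⊔ Ideal.span {h} ≤ RingHom.ker (eval y) :=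
      sup_le (fun g hg => hy g hg) ((Ideal.span_singleton_le_iff_mem _).2 hyh)
    obtain ⟨v, hv⟩ := H y (fun g hg => hle hg) hyQ
    exact ⟨v, fun g hg => hv g (Ideal.mem_sup_left hg)⟩
  by_cases hI : I = ⊤
  · exact ⟨1, one_ne_zero, fun y hy => absurd (hy 1 (hI ▸ Submodule.mem_top)) (by simp)⟩
  by_cases hprime : I.IsPrime
  · by_cases hP : ∀ Q : MvPolynomial τ ℂ, rename Sum.inr Q ∈ I → Q = 0
    · obtain ⟨h, hh, H⟩ := exists_lift_off_of_isPrime I hP t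
      obtain ⟨Q, hQ, H'⟩ := key h hh
      refine ⟨Q, hQ, fun y hy hyQ => ?_⟩
      by_cases hyh : eval y h = 0
      · exact H' y hy hyh hyQ
      · exact H y hy hyh
    · push Not at hP
      obtain ⟨Q, hQI, hQ⟩ := hP
      refine ⟨Q, hQ, fun y hy hyQ => absurd (hy _ hQI) ?_⟩
      rwa [eval_rename]
  · rw [Ideal.isPrime_iff] at hprime
    push Not at hprime
    obtain ⟨a, b, hab, ha, hb⟩ := hprime hI
    obtain ⟨Qa, hQa, Ha⟩ := key a ha
    obtain ⟨Qb, hQb, Hb⟩ := key b hb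
    refine ⟨Qa * Qb, mul_ne_zero hQa hQb, fun y hy hyQ => ?_⟩
    rw [map_mul] at hyQ
    have h0 := hy _ hab
    rw [map_mul] at h0
    rcases mul_eq_zero.1 h0 with h | h
    · exact Ha y hy h (left_ne_zero_of_mul hyQ)
    · exact Hb y hy h (right_ne_zero_of_mul hyQ)

noncomputable section

namespace QuinticCurves

/-! ### The differential of the pull-back and generic quintics -/

/-- The differential at `c` of `c ↦ c^*(f)`. -/
def dpull {d : ℕ} (f : MvPolynomial (Fin 5) ℂ) (c : M d) : M d →ₗ[ℂ] MvPolynomial (Fin 2) ℂ where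
  toFun α := ∑ i, pull c (pderiv i f) * form α i
  map_add' α β := by
    simp [form, add_mul, mul_add, Finset.sum_add_distrib]
  map_smul' r α := by
    simp only [form, Pi.smul_apply, smul_eq_mul, C_mul, RingHom.id_apply, smul_eq_C_mul,
      Finset.mul_sum]
    exact Finset.sum_congr rfl fun i _ => Finset.sum_congr rfl fun j _ => by ring

theorem dpull_apply {d : ℕ} (f : MvPolynomial (Fin 5) ℂ) (c α : M d) :
    dpull f c α = ∑ i, pull c (pderiv i f) * form α i := rfl

theorem map_eval_aeval_univForm {d : ℕ} (c : M d) (f : MvPolynomial (Fin 5) ℂ) :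
    map (eval c) (aeval (univForm d) f) = pull c f := by
  have h : ((mapAlgHom (aeval c : MvPolynomial (Idx d) ℂ →ₐ[ℂ] ℂ)).comp (aeval (univForm d)) :
      MvPolynomial (Fin 5) ℂ →ₐ[ℂ] MvPolynomial (Fin 2) ℂ) = aeval (form c) := by
    ext1 i
    simp [univForm, form]
  exact DFunLike.congr_fun h f

theorem map_eval_univForm {d : ℕ} (c : M d) (i : Fin 5) :
    map (eval c) (univForm d i) = form c i := by
  simp [univForm, form]

theorem dpull_mul_X {d : ℕ} (p : MvPolynomial (Fin 5) ℂ) (i : Fin 5) (c α : M d) :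
    dpull (p * X i) c α = dpull p c α * form c i + pull c p * form α i := by
  have h : ∀ j, pull c (pderiv j (p * X i)) * form α j =
      pull c (pderiv j p) * form α j * form c i + if j = i then pull c p * form α i else 0 := by
    intro j
    rw [Derivation.leibniz, pderiv_X, pull, map_add, smul_eq_mul, smul_eq_mul, map_mul, map_mul,
      aeval_X, Pi.single_apply]
    by_cases hj : j = i
    · subst hj
      rw [if_pos rfl, if_pos rfl, map_one, pull, pull]
      ring
    · rw [if_neg fun e => hj e.symm, if_neg hj, map_zero, pull]
      ring
  simp only [dpull_apply, h, Finset.sum_add_distrib, Finset.sum_mul, Finset.sum_ite_eq',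
    Finset.mem_univ, if_true]

theorem eval_pullCoeff {d : ℕ} (c : M d) (f : MvPolynomial (Fin 5) ℂ) (n : Fin 2 →₀ ℕ) :
    eval c (pullCoeff d f n) = coeff n (pull c f) := by
  rw [pullCoeff, ← coeff_map, map_eval_aeval_univForm]

/-- The derivative at `c` in the direction `α` of the coefficients of `c^*(f)` is given by
`dpull f c α = df(c) · α`. -/
theorem sum_eval_pderiv_pullCoeff {d : ℕ} (c α : M d) (f : MvPolynomial (Fin 5) ℂ)
    (n : Fin 2 →₀ ℕ) :
    ∑ k, α k * eval c (pderiv k (pullCoeff d f n)) = coeff n (dpull f c α) := by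
  classical
  -- the derivative at `c` in the direction `α`, first on scalars and then coefficientwise
  let L : MvPolynomial (Idx d) ℂ →ₗ[ℂ] ℂ :=
    ∑ k, α k • (aeval c : MvPolynomial (Idx d) ℂ →ₐ[ℂ] ℂ).toLinearMap ∘ₗ
      (pderiv k : Derivation ℂ _ _).toLinearMap
  have hL : ∀ g, L g = ∑ k, α k * eval c (pderiv k g) := fun g => by simp [L]
  have hLmul : ∀ g h, L (g * h) = L g * eval c h + eval c g * L h := fun g h => by
    simp only [hL, Derivation.leibniz, smul_eq_mul, map_add, map_mul, mul_add,
      Finset.sum_add_distrib, Finset.sum_mul, Finset.mul_sum]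
    rw [add_comm]
    congr 1 <;> exact Finset.sum_congr rfl fun _ _ => by ring
  -- `Lh` applies `L` to each coefficient
  let Lh : MvPolynomial (Fin 2) (MvPolynomial (Idx d) ℂ) → MvPolynomial (Fin 2) ℂ :=
    fun G => ∑ m ∈ G.support, monomial m (L (coeff m G))
  have hLh : ∀ G m, coeff m (Lh G) = L (coeff m G) := fun G m => by
    simp only [Lh, coeff_sum, coeff_monomial]
    rw [Finset.sum_ite_eq' G.support m]
    split_ifs with h
    · rfl
    · rw [notMem_support_iff.1 h, map_zero]
  have hLhmul : ∀ G H, Lh (G * H) = Lh G * map (eval c) H + map (eval c) G * Lh H := by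
    intro G H
    ext m
    simp only [coeff_add, coeff_mul, hLh, map_sum, hLmul, coeff_map, Finset.sum_add_distrib]
  have hLhadd : ∀ G H, Lh (G + H) = Lh G + Lh H := fun G H => by
    ext m; simp [hLh]
  have hX : ∀ i, Lh (univForm d i) = form α i := fun i => by
    ext m
    simp only [hLh, univForm, form, coeff_sum, map_sum]
    refine Finset.sum_congr rfl fun j _ => ?_
    rw [mul_assoc, mul_assoc, coeff_C_mul, coeff_C_mul]
    have : (X 0 ^ (d - (j : ℕ)) * X 1 ^ (j : ℕ) : MvPolynomial (Fin 2) (MvPolynomial (Idx d) ℂ)) =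
        map C (X 0 ^ (d - (j : ℕ)) * X 1 ^ (j : ℕ)) := by simp
    rw [this, coeff_map, hLmul, eval_C]
    simp [hL, pderiv_X, Pi.single_apply]
  have hmain : Lh (aeval (univForm d) f) = dpull f c α := by
    induction f using MvPolynomial.induction_on with
    | C r =>
      ext m
      have h0 : dpull (C r) c α = 0 := by simp [dpull_apply, pull]
      rw [hLh, aeval_C, h0, IsScalarTower.algebraMap_apply ℂ (MvPolynomial (Idx d) ℂ),
        algebraMap_eq, algebraMap_eq, coeff_C]
      split_ifs <;> simp [hL]
    | add p q hp hq =>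
      rw [map_add, hLhadd, hp, hq]
      simp [dpull_apply, pull, add_mul, Finset.sum_add_distrib]
    | mul_X p i hp =>
      rw [map_mul, hLhmul, hp, aeval_X, hX, map_eval_aeval_univForm, map_eval_univForm,
        dpull_mul_X]
  rw [← hmain, hLh, ← hL, pullCoeff]

theorem mem_zariskiTangent_span {σ : Type} [Fintype σ] {S : Set (MvPolynomial σ ℂ)} {p : σ → ℂ}
    (hS : ∀ g ∈ S, eval p g = 0) {α : σ → ℂ} :
    α ∈ zariskiTangent (Ideal.span S) p ↔ ∀ g ∈ S, ∑ k, α k * eval p (pderiv k g) = 0 := by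
  refine ⟨fun h g hg => h g (Ideal.subset_span hg), fun h g hg => ?_⟩
  suffices eval p g = 0 ∧ ∑ k, α k * eval p (pderiv k g) = 0 from this.2
  induction hg using Submodule.span_induction with
  | mem g hg => exact ⟨hS g hg, h g hg⟩
  | zero => simp
  | add x y _ _ hx hy =>
    simp [hx.1, hy.1, mul_add, Finset.sum_add_distrib, hx.2, hy.2]
  | smul a x _ hx =>
    simp only [smul_eq_mul, map_mul, hx.1, mul_zero, Derivation.leibniz, map_add, true_and,
      zero_mul, add_zero]
    simp only [mul_left_comm _ (eval p a), ← Finset.mul_sum, hx.2, mul_zero]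

theorem mem_tangentI {d : ℕ} {f : MvPolynomial (Fin 5) ℂ} {c : M d} (hc : pull c f = 0) {α : M d} :
    α ∈ tangentI f c ↔ dpull f c α = 0 := by
  rw [tangentI, incidenceIdeal, mem_zariskiTangent_span]
  · simp only [Set.forall_mem_range, sum_eval_pderiv_pullCoeff]
    exact ⟨fun h => by ext n; simpa using h n, fun h n => by simp [h]⟩
  · rintro _ ⟨n, rfl⟩
    rw [eval_pullCoeff, hc, coeff_zero]

theorem dpull_smul {d : ℕ} (f : MvPolynomial (Fin 5) ℂ) (c : M d) (r : ℂ) :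
    dpull (r • f) c = r • dpull f c := by
  refine LinearMap.ext fun α => ?_
  simp [dpull_apply, pull, Finset.smul_sum]

theorem dpull_sum {d : ℕ} {ι : Type*} (s : Finset ι) (f : ι → MvPolynomial (Fin 5) ℂ) (c : M d) :
    dpull (∑ m ∈ s, f m) c = ∑ m ∈ s, dpull (f m) c := by
  refine LinearMap.ext fun α => ?_
  simp only [dpull_apply, pull, map_sum, LinearMap.sum_apply, Finset.sum_mul]
  exact Finset.sum_comm

/-- Every first order deformation of the quintic `f₀` lifts to one of each curve `c` on it: for
each quintic `f`, the form `c^*(f)` is of the form `df₀(c) · α`. The tuple `c` may be any point of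
the affine space `M d`. -/
def DeformsWith (d : ℕ) (f₀ : MvPolynomial (Fin 5) ℂ) : Prop :=
  ∀ c : M d, pull c f₀ = 0 → ∀ f : MvPolynomial (Fin 5) ℂ, f.IsHomogeneous 5 →
    pull c f ∈ LinearMap.range (dpull f₀ c)

theorem DeformsWith.of_smul {d : ℕ} {f : MvPolynomial (Fin 5) ℂ} {r : ℂ} (hr : r ≠ 0)
    (h : DeformsWith d (r • f)) : DeformsWith d f := by
  intro c hc g hg
  have h1 := h c (by simp only [pull] at hc ⊢; rw [map_smul, hc, smul_zero]) g hg
  rw [dpull_smul, LinearMap.range_smul _ _ hr] at h1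
  exact h1

instance : Finite {m : Fin 5 →₀ ℕ // m.degree = 5} := (Finsupp.finite_of_degree_eq 5).to_subtype
instance : Fintype {m : Fin 5 →₀ ℕ // m.degree = 5} := Fintype.ofFinite _

theorem sum_coeff_smul_monomial {f : MvPolynomial (Fin 5) ℂ} (hf : f.IsHomogeneous 5) :
    ∑ m : {m : Fin 5 →₀ ℕ // m.degree = 5}, coeff m.1 f • monomial m.1 (1 : ℂ) = f := by
  classical
  ext n
  simp only [coeff_sum, coeff_smul, coeff_monomial, smul_eq_mul, mul_ite, mul_one, mul_zero]
  by_cases hn : n.degree = 5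
  · rw [Finset.sum_eq_single ⟨n, hn⟩]
    · simp
    · intro b _ hb
      rw [if_neg fun h => hb (Subtype.ext h)]
    · simp
  · rw [hf.coeff_eq_zero hn]
    exact Finset.sum_eq_zero fun b _ => if_neg fun h => hn (by rw [← h]; exact b.2)

/-- The ideal of the universal incidence scheme `{(c, f) : c^*(f) = 0}`. -/
def univIncidenceIdeal (d : ℕ) :
    Ideal (MvPolynomial (Idx d ⊕ {m : Fin 5 →₀ ℕ // m.degree = 5}) ℂ) :=
  Ideal.span (Set.range fun n : Fin 2 →₀ ℕ => ∑ m : {m : Fin 5 →₀ ℕ // m.degree = 5},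
    X (Sum.inr m) * rename Sum.inl (pullCoeff d (monomial m.1 1) n))

/-- Generic smoothness of the universal incidence scheme over the space of quintics: the lift of the
deformation by the monomial `m` to a curve `c` on `f` is an `α` with `df(c) · α + c^*(m) = 0`. -/
theorem exists_deformsWith (d : ℕ) : ∃ Q : MvPolynomial {m : Fin 5 →₀ ℕ // m.degree = 5} ℂ,
    Q ≠ 0 ∧ ∀ f : MvPolynomial (Fin 5) ℂ, f.IsHomogeneous 5 →
      eval (fun m : {m : Fin 5 →₀ ℕ // m.degree = 5} => coeff m.1 f) Q ≠ 0 → DeformsWith d f := by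
  classical
  choose Q hQ H using exists_lift_over_generic (univIncidenceIdeal d)
  refine ⟨∏ t, Q t, Finset.prod_ne_zero_iff.2 fun t _ => hQ t, fun f hf hfQ c hc g hg => ?_⟩
  rw [map_prod, Finset.prod_ne_zero_iff] at hfQ
  let y : Idx d ⊕ {m : Fin 5 →₀ ℕ // m.degree = 5} → ℂ := Sum.elim c fun m => coeff m.1 f
  have hyl : ∀ p, eval y (rename Sum.inl p) = eval c p := fun p => by rw [eval_rename]; rfl
  have hy : ∀ g ∈ univIncidenceIdeal d, eval y g = 0 := by
    have : univIncidenceIdeal d ≤ RingHom.ker (eval y) := by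
      rw [univIncidenceIdeal, Ideal.span_le]
      rintro _ ⟨n, rfl⟩
      rw [SetLike.mem_coe, RingHom.mem_ker]
      have h1 : coeff n (pull c f) = 0 := by rw [hc, coeff_zero]
      rw [← sum_coeff_smul_monomial hf] at h1
      simpa [hyl, eval_pullCoeff, y, pull, coeff_sum] using h1
    exact fun g hg => this hg
  have hmon : ∀ t : {m : Fin 5 →₀ ℕ // m.degree = 5},
      pull c (monomial t.1 1) ∈ LinearMap.range (dpull f c) := by
    intro t
    obtain ⟨v, hv⟩ := H t y hy (hfQ t (Finset.mem_univ t))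
    refine ⟨-v, ?_⟩
    rw [map_neg, neg_eq_iff_add_eq_zero]
    ext n
    have h1 := hv _ (Ideal.subset_span ⟨n, rfl⟩)
    have h2 : ∀ (k : Idx d) (p : MvPolynomial (Idx d) ℂ),
        pderiv (Sum.inl k : Idx d ⊕ {m : Fin 5 →₀ ℕ // m.degree = 5}) (rename Sum.inl p) =
          rename Sum.inl (pderiv k p) := fun k p => pderiv_rename Sum.inl_injective k p
    have h3 : ∀ (p : MvPolynomial (Idx d) ℂ),
        pderiv (Sum.inr t : Idx d ⊕ {m : Fin 5 →₀ ℕ // m.degree = 5}) (rename Sum.inl p) = 0 :=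
      fun p => by
        refine pderiv_eq_zero_of_notMem_vars fun h => ?_
        obtain ⟨k, _, hk⟩ := Finset.mem_image.1 (vars_rename Sum.inl p h)
        exact Sum.inl_ne_inr hk
    simp only [map_sum, Derivation.leibniz, h2, h3, smul_eq_mul, pderiv_X, map_add, map_mul,
      hyl, eval_X, eval_pullCoeff] at h1
    rw [coeff_add, coeff_zero, ← h1]
    congr 1
    · conv_lhs => rw [← sum_coeff_smul_monomial hf]
      simp only [dpull_sum, dpull_smul, LinearMap.sum_apply, LinearMap.smul_apply, coeff_sum,
        coeff_smul, ← sum_eval_pderiv_pullCoeff, smul_eq_mul, Finset.mul_sum]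
      rw [Finset.sum_comm]
      refine Finset.sum_congr rfl fun k _ => Finset.sum_congr rfl fun m _ => ?_
      simp [y]
      ring
    · simp [Pi.single_apply]
  rw [← sum_coeff_smul_monomial hg]
  simp only [pull, map_sum, map_smul] at hmon ⊢
  exact Submodule.sum_mem _ fun m _ => Submodule.smul_mem _ _ (hmon m)

theorem eval_smul_of_isHomogeneous {σ R : Type*} [CommSemiring R] {φ : MvPolynomial σ R} {n : ℕ}
    (hφ : φ.IsHomogeneous n) (r : R) (a : σ → R) : eval (r • a) φ = r ^ n * eval a φ := by
  rw [eval_eq, eval_eq, Finset.mul_sum]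
  refine Finset.sum_congr rfl fun m hm => ?_
  have h : m.degree = n := by
    by_contra h
    exact mem_support_iff.1 hm (hφ.coeff_eq_zero h)
  rw [← h, Finsupp.degree_apply, ← Finset.prod_pow_eq_pow_sum]
  simp only [Pi.smul_apply, smul_eq_mul, mul_pow, Finset.prod_mul_distrib]
  ring

theorem forGenericQuintic_deformsWith (d : ℕ) : ForGenericQuintic (DeformsWith d) := by
  obtain ⟨Q, hQ, H⟩ := exists_deformsWith d
  obtain ⟨n, hn⟩ : ∃ n, homogeneousComponent n Q ≠ 0 := by
    by_contra! h
    exact hQ (by rw [← sum_homogeneousComponent Q, Finset.sum_eq_zero fun i _ => h i])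
  refine ⟨n, homogeneousComponent n Q, homogeneousComponent_isHomogeneous n Q, hn,
    fun f hf _ hfn => ?_⟩
  -- `Q` is a nonzero polynomial function on the line through `f`, so some multiple of `f` is good
  let a : {m : Fin 5 →₀ ℕ // m.degree = 5} → ℂ := fun m => coeff m.1 f
  let q : Polynomial ℂ := ∑ i ∈ Finset.range (Q.totalDegree + 1),
    Polynomial.monomial i (eval a (homogeneousComponent i Q))
  have hq : q ≠ 0 := by
    intro h0
    have h1 : q.coeff n = 0 := by rw [h0, Polynomial.coeff_zero]
    simp only [q, Polynomial.finsetSum_coeff, Polynomial.coeff_monomial, Finset.sum_ite_eq'] at h1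
    split_ifs at h1 with h2
    · exact hfn h1
    · refine hn (homogeneousComponent_eq_zero _ _ ?_)
      simpa using h2
  obtain ⟨r, hr⟩ : ∃ r : ℂ, (q * Polynomial.X).eval r ≠ 0 := by
    by_contra! h
    exact mul_ne_zero hq Polynomial.X_ne_zero (Polynomial.funext fun r => by rw [h r]; simp)
  rw [Polynomial.eval_mul, Polynomial.eval_X] at hr
  refine DeformsWith.of_smul (right_ne_zero_of_mul hr) (H _ (by
    simpa [smul_eq_C_mul] using (isHomogeneous_C (Fin 5) r).mul hf) ?_)
  convert left_ne_zero_of_mul hr using 1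
  conv_lhs => rw [← sum_homogeneousComponent Q]
  simp only [q, map_sum, Polynomial.eval_finsetSum, Polynomial.eval_monomial]
  refine Finset.sum_congr rfl fun i _ => ?_
  have h3 : (fun m : {m : Fin 5 →₀ ℕ // m.degree = 5} => coeff m.1 (r • f)) = r • a := by
    ext m; simp [a]
  rw [h3, eval_smul_of_isHomogeneous (homogeneousComponent_isHomogeneous i Q), mul_comm]

/-! ### Tangent spaces of the incidence schemes over a pencil -/

theorem mem_tangentGammaPencil {d : ℕ} {f₀ f₂ : MvPolynomial (Fin 5) ℂ} {c : M d}
    (hc : pull c f₀ = 0) {β : Option (Idx d) → ℂ} :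
    β ∈ tangentGammaPencil f₀ f₂ c ↔
      dpull f₀ c (fun k => β (some k)) + β none • pull c f₂ = 0 := by
  classical
  have hs : ∀ p : MvPolynomial (Idx d) ℂ,
      eval (fun k : Option (Idx d) => k.elim 0 c) (rename some p) = eval c p := fun p => by
    rw [eval_rename]; rfl
  have hd : ∀ (k : Idx d) (p : MvPolynomial (Idx d) ℂ),
      pderiv (some k) (rename some p) = rename some (pderiv k p) :=
    fun k p => pderiv_rename (Option.some_injective _) k p
  have hn : ∀ p : MvPolynomial (Idx d) ℂ, pderiv (none : Option (Idx d)) (rename some p) = 0 :=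
    fun p => pderiv_eq_zero_of_notMem_vars fun h => by
      obtain ⟨k, _, hk⟩ := Finset.mem_image.1 (vars_rename some p h)
      exact Option.some_ne_none k hk
  rw [tangentGammaPencil, pencilIncidenceIdeal, mem_zariskiTangent_span]
  · have key : ∀ m, ∑ k, β k * eval (fun k : Option (Idx d) => k.elim 0 c) (pderiv k
        (rename some (pullCoeff d f₀ m) + X none * rename some (pullCoeff d f₂ m))) =
        coeff m (dpull f₀ c (fun k => β (some k)) + β none • pull c f₂) := by
      intro m
      rw [Fintype.sum_option, coeff_add, ← sum_eval_pderiv_pullCoeff, coeff_smul,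
        ← eval_pullCoeff, add_comm]
      congr 1
      · refine Finset.sum_congr rfl fun k _ => ?_
        simp [Derivation.leibniz, hd, hs]
      · simp [Derivation.leibniz, hn, hs]
    simp only [Set.forall_mem_range, key]
    exact ⟨fun h => by ext m; simpa using h m, fun h m => by rw [h, coeff_zero]⟩
  · rintro _ ⟨n, rfl⟩
    simp [hs, eval_pullCoeff, hc]

theorem mem_tangentIPencil {d : ℕ} {f₀ f₂ : MvPolynomial (Fin 5) ℂ} {c : M d}
    (hc : pull c f₀ = 0) (h₂ : pull c f₂ ≠ 0) {α : M d} :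
    α ∈ tangentIPencil f₀ f₂ c ↔ ∃ r : ℂ, dpull f₀ c α = r • pull c f₂ := by
  rw [tangentIPencil, projectedIdeal, mem_zariskiTangent_span]
  · have key : ∀ m n, ∑ k, α k * eval c (pderiv k
        (pullCoeff d f₀ m * pullCoeff d f₂ n - pullCoeff d f₀ n * pullCoeff d f₂ m)) =
        coeff m (dpull f₀ c α) * coeff n (pull c f₂) -
          coeff n (dpull f₀ c α) * coeff m (pull c f₂) := by
      intro m n
      simp only [← sum_eval_pderiv_pullCoeff, Finset.sum_mul, ← Finset.sum_sub_distrib]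
      refine Finset.sum_congr rfl fun k _ => ?_
      simp only [map_sub, Derivation.leibniz, smul_eq_mul, map_add, map_mul, eval_pullCoeff, hc,
        coeff_zero, zero_mul, zero_add]
      ring
    constructor
    · intro h
      obtain ⟨n, hn⟩ : ∃ n, coeff n (pull c f₂) ≠ 0 := by
        by_contra! h0
        exact h₂ (by ext n; simp [h0])
      refine ⟨coeff n (dpull f₀ c α) / coeff n (pull c f₂), ?_⟩
      ext m
      have h1 := h _ ⟨m, n, rfl⟩
      rw [key] at h1
      rw [coeff_smul, smul_eq_mul]
      field_simp
      linear_combination h1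
    · rintro ⟨r, hr⟩ _ ⟨m, n, rfl⟩
      rw [key, hr]
      simp only [coeff_smul, smul_eq_mul]
      ring
  · rintro _ ⟨m, n, rfl⟩
    simp [eval_pullCoeff, hc]

/-- If `c^*(f₂) = df₀(c) · v`, then `T_c I_{𝕃₂}` is spanned by `T_c I_{f₀}` and `v`. -/
theorem finrank_tangentIPencil {d : ℕ} {f₀ f₂ : MvPolynomial (Fin 5) ℂ} {c : M d}
    (hc : pull c f₀ = 0) (h₂ : pull c f₂ ≠ 0) (h : pull c f₂ ∈ LinearMap.range (dpull f₀ c)) :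
    Module.finrank ℂ (tangentIPencil f₀ f₂ c) = Module.finrank ℂ (tangentI f₀ c) + 1 := by
  obtain ⟨v, hv⟩ := h
  have hmem : ∀ x : tangentI f₀ c × ℂ, (x.1 : M d) + x.2 • v ∈ tangentIPencil f₀ f₂ c := fun x =>
    (mem_tangentIPencil hc h₂).2 ⟨x.2, by
      rw [map_add, (mem_tangentI hc).1 x.1.2, map_smul, hv, zero_add]⟩
  let φ : (tangentI f₀ c × ℂ) →ₗ[ℂ] tangentIPencil f₀ f₂ c :=
    LinearMap.codRestrict _
      ((tangentI f₀ c).subtype.coprod (LinearMap.toSpanSingleton ℂ (M d) v)) hmem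
  have hφ : Function.Bijective φ := by
    constructor
    · rw [injective_iff_map_eq_zero]
      rintro ⟨k, r⟩ hx
      have h1 : (k : M d) + r • v = 0 := congrArg Subtype.val hx
      have h2 := congrArg (dpull f₀ c) h1
      rw [map_add, (mem_tangentI hc).1 k.2, map_smul, hv, zero_add, map_zero, smul_eq_zero] at h2
      have h3 := h2.resolve_right h₂
      subst h3
      rw [zero_smul, add_zero] at h1
      exact Prod.ext (Subtype.ext h1) rfl
    · rintro ⟨α, hα⟩
      obtain ⟨r, hr⟩ := (mem_tangentIPencil hc h₂).1 hα
      refine ⟨(⟨α - r • v, (mem_tangentI hc).2 (by rw [map_sub, map_smul, hv, hr, sub_self])⟩, r),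
        Subtype.ext ?_⟩
      exact sub_add_cancel α (r • v)
  rw [← (LinearEquiv.ofBijective φ hφ).finrank_eq, Module.finrank_prod, Module.finrank_self]

/-- The projection `(α, u) ↦ α` identifies the two tangent spaces, since `c^*(f₂) ≠ 0` determines
`u` from `α`. -/
theorem finrank_tangentGammaPencil {d : ℕ} {f₀ f₂ : MvPolynomial (Fin 5) ℂ} {c : M d}
    (hc : pull c f₀ = 0) (h₂ : pull c f₂ ≠ 0) :
    Module.finrank ℂ (tangentGammaPencil f₀ f₂ c) =
      Module.finrank ℂ (tangentIPencil f₀ f₂ c) := by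
  let φ : tangentGammaPencil f₀ f₂ c →ₗ[ℂ] tangentIPencil f₀ f₂ c :=
    ((LinearMap.funLeft ℂ ℂ (some : Idx d → Option (Idx d))).comp
      (Submodule.subtype _)).codRestrict _ fun β =>
        (mem_tangentIPencil hc h₂).2 ⟨-β.1 none, by
          rw [neg_smul]; exact eq_neg_of_add_eq_zero_left ((mem_tangentGammaPencil hc).1 β.2)⟩
  refine (LinearEquiv.ofBijective φ ⟨?_, ?_⟩).finrank_eq
  · rw [injective_iff_map_eq_zero]
    rintro ⟨β, hβ⟩ h
    have h1 : (fun k => β (some k)) = 0 := congrArg Subtype.val h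
    have h2 := (mem_tangentGammaPencil hc).1 hβ
    rw [h1, map_zero, zero_add, smul_eq_zero] at h2
    refine Subtype.ext (funext fun k => ?_)
    cases k with
    | none => exact h2.resolve_right h₂
    | some k => exact congrFun h1 k
  · rintro ⟨α, hα⟩
    obtain ⟨r, hr⟩ := (mem_tangentIPencil hc h₂).1 hα
    exact ⟨⟨fun k => k.elim (-r) α, (mem_tangentGammaPencil hc).2 (by
      change dpull f₀ c α + (-r) • pull c f₂ = 0
      rw [hr, neg_smul, add_neg_cancel])⟩, rfl⟩

/-! ### Binary forms and sections of `𝒪(n)` on the projective line -/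

theorem laurent_eq_sum (p : ℂ[T;T⁻¹]) :
    p = ∑ k ∈ p.coeff.support, p.coeff k • LaurentPolynomial.T k := by
  classical
  refine LaurentPolynomial.ext fun n => ?_
  simp [Finset.sum_apply', LaurentPolynomial.T_apply]

/-- `ℂ[z]` and `ℂ[z⁻¹]` in terms of the exponents that occur. -/
theorem mem_adjoin_T {e : ℤ} (he : e = 1 ∨ e = -1) {p : ℂ[T;T⁻¹]} :
    p ∈ Algebra.adjoin ℂ {(LaurentPolynomial.T e : ℂ[T;T⁻¹])} ↔
      ∀ k, e * k < 0 → p.coeff k = 0 := by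
  constructor
  · intro hp k hk
    rw [Algebra.adjoin_singleton_eq_range_aeval] at hp
    obtain ⟨q, rfl⟩ := hp
    rw [AlgHom.toRingHom_eq_coe, RingHom.coe_coe, Polynomial.aeval_eq_sum_range]
    simp only [LaurentPolynomial.T_pow, AddMonoidAlgebra.coeff_sum, AddMonoidAlgebra.coeff_smul,
      Finset.sum_apply', Finsupp.smul_apply, LaurentPolynomial.T_apply]
    refine Finset.sum_eq_zero fun i _ => ?_
    rw [if_neg, smul_zero]
    rintro rfl
    rcases he with rfl | rfl <;> omega
  · intro h
    rw [laurent_eq_sum p]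
    refine Subalgebra.sum_mem _ fun k hk => Subalgebra.smul_mem _ ?_ _
    have h1 : 0 ≤ e * k := by
      by_contra h1
      exact Finsupp.mem_support_iff.1 hk (h k (by omega))
    have h2 : LaurentPolynomial.T k = (LaurentPolynomial.T e : ℂ[T;T⁻¹]) ^ (e * k).toNat := by
      rw [LaurentPolynomial.T_pow]
      congr 1
      rcases he with rfl | rfl <;> omega
    rw [h2]
    exact Subalgebra.pow_mem _ (Algebra.self_mem_adjoin_singleton ℂ _) _

theorem mem_twist_zero {n : ℕ} {p : ℂ[T;T⁻¹]} : p ∈ twist n .zero ↔ ∀ k < 0, p.coeff k = 0 := by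
  rw [twist, Subalgebra.mem_toSubmodule, mem_adjoin_T (.inl rfl)]
  simp

theorem mem_twist_one {n : ℕ} {p : ℂ[T;T⁻¹]} :
    p ∈ twist n .one ↔ ∀ k, (n : ℤ) < k → p.coeff k = 0 := by
  have hT : ∀ q : ℂ[T;T⁻¹], LaurentPolynomial.T n * (LaurentPolynomial.T (-n) * q) = q := fun q => by
    rw [← mul_assoc, ← LaurentPolynomial.T_add, add_neg_cancel, LaurentPolynomial.T_zero, one_mul]
  have h1 : p ∈ twist n .one ↔
      LaurentPolynomial.T (-n) * p ∈ Algebra.adjoin ℂ {(LaurentPolynomial.T (-1) : ℂ[T;T⁻¹])} := by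
    constructor
    · rintro ⟨q, hq, rfl⟩
      rw [LinearMap.mulLeft_apply, ← mul_assoc, ← LaurentPolynomial.T_add, neg_add_cancel,
        LaurentPolynomial.T_zero, one_mul]
      exact hq
    · exact fun h => ⟨_, h, hT p⟩
  have h2 : ∀ k, (LaurentPolynomial.T (-n) * p).coeff k = p.coeff (k + n) := fun k => by
    rw [LaurentPolynomial.T_mul, LaurentPolynomial.T, AddMonoidAlgebra.coeff_mul_single_apply]
    simp
  rw [h1, mem_adjoin_T (.inr rfl)]
  simp only [h2]
  constructor
  · intro h k hk
    have := h (k - n) (by omega)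
    rwa [sub_add_cancel] at this
  · exact fun h k hk => h _ (by omega)

theorem mul_mem_twist {m n : ℕ} {U : Chart} {p q : ℂ[T;T⁻¹]} (hp : p ∈ twist m U)
    (hq : q ∈ twist n U) : p * q ∈ twist (m + n) U := by
  cases U with
  | zero => exact Subalgebra.mul_mem _ hp hq
  | one =>
    obtain ⟨x, hx, rfl⟩ := hp
    obtain ⟨y, hy, rfl⟩ := hq
    refine ⟨x * y, Subalgebra.mul_mem _ hx hy, ?_⟩
    simp only [LinearMap.mulLeft_apply, Nat.cast_add, LaurentPolynomial.T_add]
    ring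
  | overlap => trivial

/-- Every Laurent polynomial is a difference of sections of `𝒪(n)` over the two charts, that is,
`H¹(𝒪(n)) = 0`. -/
theorem exists_twist_sub (n : ℕ) (p : ℂ[T;T⁻¹]) :
    ∃ p₀ ∈ twist n .zero, ∃ p₁ ∈ twist n .one, p = p₀ - p₁ := by
  classical
  refine ⟨.ofCoeff (p.coeff.filter (0 ≤ ·)), mem_twist_zero.2 fun k hk => ?_,
    -.ofCoeff (p.coeff.filter (¬ 0 ≤ ·)), mem_twist_one.2 fun k hk => ?_, ?_⟩
  · exact Finsupp.filter_apply_neg _ _ (by omega)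
  · rw [AddMonoidAlgebra.coeff_neg, Finsupp.neg_apply, neg_eq_zero]
    exact Finsupp.filter_apply_neg _ _ (by omega)
  · refine LaurentPolynomial.ext fun k => ?_
    rw [sub_neg_eq_add, AddMonoidAlgebra.coeff_add]
    rw [Finsupp.filter_add_filter_not]

/-- The binary form `∑ⱼ aⱼ x₀^{n-j} x₁^j`. -/
def binForm (n : ℕ) (a : Fin (n + 1) → ℂ) : MvPolynomial (Fin 2) ℂ :=
  ∑ j : Fin (n + 1), C (a j) * X 0 ^ (n - (j : ℕ)) * X 1 ^ (j : ℕ)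

theorem form_eq_binForm {d : ℕ} (c : M d) (i : Fin 5) :
    form c i = binForm d (fun j => c (i, j)) := rfl

theorem binForm_isHomogeneous (n : ℕ) (a : Fin (n + 1) → ℂ) : (binForm n a).IsHomogeneous n := by
  refine IsHomogeneous.sum _ _ _ fun j _ => ?_
  have h := ((isHomogeneous_C (Fin 2) (a j)).mul ((isHomogeneous_X ℂ (0 : Fin 2)).pow
    (n - (j : ℕ)))).mul ((isHomogeneous_X ℂ (1 : Fin 2)).pow (j : ℕ))
  convert h using 1
  have := j.2
  omega

theorem exists_binForm_eq {n : ℕ} {F : MvPolynomial (Fin 2) ℂ} (hF : F.IsHomogeneous n) :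
    ∃ a, binForm n a = F := by
  classical
  refine ⟨fun j => coeff (Finsupp.single 0 (n - (j : ℕ)) + Finsupp.single 1 (j : ℕ)) F, ?_⟩
  have h1 : ∀ (r : ℂ) (k l : ℕ), C r * X 0 ^ k * X 1 ^ l =
      monomial (Finsupp.single (0 : Fin 2) k + Finsupp.single 1 l) r := fun r k l => by
    rw [X_pow_eq_monomial, X_pow_eq_monomial, mul_assoc, monomial_mul, C_mul_monomial]; simp
  ext m
  simp only [binForm, h1, coeff_sum, coeff_monomial]
  have hm : m.degree = m 0 + m 1 := by
    simp [Finsupp.degree_eq_sum]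
  by_cases h : m.degree = n
  · rw [Finset.sum_eq_single ⟨m 1, by omega⟩]
    · have : Finsupp.single (0 : Fin 2) (n - m 1) + Finsupp.single 1 (m 1) = m := by
        ext i; fin_cases i <;> simp; omega
      rw [this, if_pos rfl]
    · intro b _ hb
      refine if_neg fun e => hb (Fin.ext ?_)
      have := DFunLike.congr_fun e 1
      simpa using this
    · simp
  · rw [hF.coeff_eq_zero h]
    refine Finset.sum_eq_zero fun j _ => if_neg fun e => h ?_
    rw [hm, ← e]
    have := j.2
    simp
    omega

theorem dehom_binForm (n : ℕ) (a : Fin (n + 1) → ℂ) :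
    dehom (binForm n a) = ∑ j : Fin (n + 1), a j • LaurentPolynomial.T (j : ℤ) := by
  simp [binForm, dehom, Algebra.smul_def]

theorem coeff_dehom_binForm (n : ℕ) (a : Fin (n + 1) → ℂ) (k : ℤ) :
    (dehom (binForm n a)).coeff k = ∑ j : Fin (n + 1), if (j : ℤ) = k then a j else 0 := by
  simp [dehom_binForm, AddMonoidAlgebra.coeff_sum, Finset.sum_apply', LaurentPolynomial.T_apply]

theorem coeff_dehom_binForm_natCast (n : ℕ) (a : Fin (n + 1) → ℂ) (j : Fin (n + 1)) :
    (dehom (binForm n a)).coeff (j : ℕ) = a j := by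
  simp [coeff_dehom_binForm, Fin.val_inj]

theorem dehom_binForm_injective (n : ℕ) : Function.Injective fun a => dehom (binForm n a) := by
  intro a b h
  funext j
  have h1 : dehom (binForm n a) = dehom (binForm n b) := h
  rw [← coeff_dehom_binForm_natCast n a, h1, coeff_dehom_binForm_natCast]

theorem dehom_mem_twist {n : ℕ} {F : MvPolynomial (Fin 2) ℂ} (hF : F.IsHomogeneous n) (U : Chart) :
    dehom F ∈ twist n U := by
  obtain ⟨a, rfl⟩ := exists_binForm_eq hF
  cases U with
  | zero =>
    refine mem_twist_zero.2 fun k hk => ?_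
    rw [coeff_dehom_binForm]
    exact Finset.sum_eq_zero fun j _ => if_neg (by omega)
  | one =>
    refine mem_twist_one.2 fun k hk => ?_
    rw [coeff_dehom_binForm]
    exact Finset.sum_eq_zero fun j _ => if_neg (by omega)
  | overlap => trivial

/-- The global sections of `𝒪(n)` are the binary forms of degree `n`. -/
theorem exists_dehom_binForm_eq {n : ℕ} {p : ℂ[T;T⁻¹]} (h₀ : p ∈ twist n .zero)
    (h₁ : p ∈ twist n .one) : ∃ a, dehom (binForm n a) = p := by
  rw [mem_twist_zero] at h₀
  rw [mem_twist_one] at h₁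
  refine ⟨fun j => p.coeff (j : ℕ), LaurentPolynomial.ext fun k => ?_⟩
  rw [coeff_dehom_binForm]
  by_cases hk : 0 ≤ k ∧ k ≤ n
  · rw [Finset.sum_eq_single ⟨k.toNat, by omega⟩]
    · rw [if_pos (by simp; omega)]
      congr 1
      simp; omega
    · intro b _ hb
      exact if_neg fun e => hb (Fin.ext (by simp; omega))
    · simp
  · rw [Finset.sum_eq_zero fun j _ => if_neg (by have := j.2; omega)]
    by_cases hk0 : k < 0
    · rw [h₀ k hk0]
    · rw [h₁ k (by omega)]

theorem eq_zero_of_dehom_eq_zero {n : ℕ} {F : MvPolynomial (Fin 2) ℂ} (hF : F.IsHomogeneous n)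
    (h : dehom F = 0) : F = 0 := by
  obtain ⟨a, rfl⟩ := exists_binForm_eq hF
  have h0 : binForm n (0 : Fin (n + 1) → ℂ) = 0 := by simp [binForm]
  have : a = 0 := dehom_binForm_injective n (by simpa [h0] using h)
  rw [this, h0]

/-! ### The cohomology of `c^*T_X` and of the normal sheaf -/

namespace SubquotientSheaf

variable {V : Type} [AddCommGroup V] [Module ℂ V] (F : SubquotientSheaf V)

theorem mem_H0 {s : F.sections .zero × F.sections .one} :
    s ∈ F.H0 ↔ F.res .zero s.1 = F.res .one s.2 := by
  rw [LinearMap.mem_ker, LinearMap.sub_apply, sub_eq_zero]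
  rfl

theorem res_cls (U : Chart) (v : V) (hv : v ∈ F.num U) :
    F.res U (F.cls U v hv) = F.cls .overlap v (F.num_le U hv) := rfl

theorem cls_eq_cls {U : Chart} {v w : V} (hv : v ∈ F.num U) (hw : w ∈ F.num U) :
    F.cls U v hv = F.cls U w hw ↔ v - w ∈ F.den U :=
  Submodule.Quotient.eq _

theorem cls_eq_zero {U : Chart} {v : V} (hv : v ∈ F.num U) :
    F.cls U v hv = 0 ↔ v ∈ F.den U :=
  Submodule.Quotient.mk_eq_zero _

theorem cls_surjective {U : Chart} (s : F.sections U) : ∃ v hv, F.cls U v hv = s := by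
  obtain ⟨⟨v, hv⟩, rfl⟩ := Submodule.Quotient.mk_surjective _ s
  exact ⟨v, hv, rfl⟩

end SubquotientSheaf

theorem form_isHomogeneous {d : ℕ} (c : M d) (i : Fin 5) : (form c i).IsHomogeneous d :=
  binForm_isHomogeneous d _

theorem vec_injective {d : ℕ} : Function.Injective (vec : M d → _) := by
  intro α β h
  funext ⟨i, j⟩
  exact congrFun (dehom_binForm_injective d (congrFun h i)) j

theorem vec_mem_twist {d : ℕ} (c : M d) (i : Fin 5) (U : Chart) : vec c i ∈ twist d U :=
  dehom_mem_twist (form_isHomogeneous c i) U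

theorem exists_vec_eq {d : ℕ} {w : Fin 5 → ℂ[T;T⁻¹]} (h₀ : ∀ i, w i ∈ twist d .zero)
    (h₁ : ∀ i, w i ∈ twist d .one) : ∃ α : M d, vec α = w := by
  choose a ha using fun i => exists_dehom_binForm_eq (h₀ i) (h₁ i)
  exact ⟨fun k => a k.1 k.2, funext fun i => by rw [vec, form_eq_binForm]; exact ha i⟩

/-- `vec` as a linear map. -/
def vecₗ (d : ℕ) : M d →ₗ[ℂ] (Fin 5 → ℂ[T;T⁻¹]) where
  toFun := vec
  map_add' α β := by
    funext i
    simp [vec, form_eq_binForm, dehom_binForm, add_smul, Finset.sum_add_distrib]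
  map_smul' r α := by
    funext i
    simp [vec, form_eq_binForm, dehom_binForm, mul_smul, Finset.smul_sum]

theorem pull_isHomogeneous {d n : ℕ} (c : M d) {f : MvPolynomial (Fin 5) ℂ}
    (hf : f.IsHomogeneous n) : (pull c f).IsHomogeneous (d * n) :=
  hf.aeval _ fun i => form_isHomogeneous c i

theorem dpull_isHomogeneous {d : ℕ} {f : MvPolynomial (Fin 5) ℂ} (hf : f.IsHomogeneous 5)
    (c α : M d) : (dpull f c α).IsHomogeneous (d * 4 + d) :=
  IsHomogeneous.sum _ _ _ fun i _ =>
    (pull_isHomogeneous c (hf.pderiv (i := i))).mul (form_isHomogeneous α i)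

theorem dehom_dpull {d : ℕ} (f : MvPolynomial (Fin 5) ℂ) (c α : M d) :
    dehom (dpull f c α) = ∑ i, dehom (pull c (pderiv i f)) * vec α i := by
  simp [dpull_apply, vec]

theorem dpull_self {d : ℕ} {f : MvPolynomial (Fin 5) ℂ} {n : ℕ} (hf : f.IsHomogeneous n) (c : M d) :
    dpull f c c = n • pull c f := by
  have h := congrArg (pull c) hf.sum_X_mul_pderiv
  simp only [pull, map_sum, map_mul, aeval_X, map_nsmul] at h
  rw [pull, ← h, dpull_apply]
  exact Finset.sum_congr rfl fun i _ => mul_comm _ _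

theorem vec_mem_kernelSections {d : ℕ} {f : MvPolynomial (Fin 5) ℂ} {c α : M d}
    (h : dpull f c α = 0) (U : Chart) : vec α ∈ kernelSections f c U :=
  ⟨fun i => vec_mem_twist α i U, by rw [← dehom_dpull, h, map_zero]⟩

theorem scale_vec_mem_kernelSections {d : ℕ} {f : MvPolynomial (Fin 5) ℂ}
    (hf : f.IsHomogeneous 5) {c : M d} (hc : pull c f = 0) {U : Chart} {a : ℂ[T;T⁻¹]}
    (ha : a ∈ twist 0 U) : scale (vec c) a ∈ kernelSections f c U := by
  have hs : ∀ i, scale (vec c) a i = a * vec c i := fun _ => rfl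
  refine ⟨fun i => ?_, ?_⟩
  · rw [hs]
    simpa using mul_mem_twist ha (vec_mem_twist c i U)
  · have h1 : ∑ i, dehom (pull c (pderiv i f)) * vec c i = 0 := by
      rw [← dehom_dpull, dpull_self hf, hc, smul_zero, map_zero]
    simp only [hs, mul_left_comm _ a, ← Finset.mul_sum, h1, mul_zero]

/-- The section of `c^*T_X` induced by a first order deformation of `c`. -/
def inducedSection {d : ℕ} {f : MvPolynomial (Fin 5) ℂ} {c : M d} (hc : pull c f = 0) :
    tangentI f c →ₗ[ℂ] (pullTangent f c).H0 :=
  let ψ (U : Chart) : tangentI f c →ₗ[ℂ] (pullTangent f c).sections U :=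
    Submodule.mkQ _ ∘ₗ (vecₗ d ∘ₗ (tangentI f c).subtype).codRestrict (kernelSections f c U)
      fun α => vec_mem_kernelSections ((mem_tangentI hc).1 α.2) U
  ((ψ .zero).prod (ψ .one)).codRestrict _ fun _ => (SubquotientSheaf.mem_H0 _).2 rfl

theorem isInducedSection_inducedSection {d : ℕ} {f : MvPolynomial (Fin 5) ℂ} {c : M d}
    (hc : pull c f = 0) (α : tangentI f c) :
    IsInducedSection f c α (inducedSection hc α) :=
  ⟨vec_mem_kernelSections ((mem_tangentI hc).1 α.2) _,
    vec_mem_kernelSections ((mem_tangentI hc).1 α.2) _, rfl⟩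

/-- A deformation induces the zero section exactly when it rescales `c`: the factor is a global
section of `𝒪`. -/
theorem inducedSection_eq_zero_iff {d : ℕ} {f : MvPolynomial (Fin 5) ℂ} {c : M d}
    (hc : pull c f = 0) (hc0 : c ≠ 0) (α : tangentI f c) :
    inducedSection hc α = 0 ↔ ∃ r : ℂ, (α : M d) = r • c := by
  have hq : inducedSection hc α = 0 ↔ vec (α : M d) ∈ (twist 0 .zero).map (scale (vec c)) ∧
      vec (α : M d) ∈ (twist 0 .one).map (scale (vec c)) := by
    have hv := vec_mem_kernelSections ((mem_tangentI hc).1 α.2) .zero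
    have hv' := vec_mem_kernelSections ((mem_tangentI hc).1 α.2) .one
    rw [Subtype.ext_iff, Prod.ext_iff]
    exact and_congr
      (SubquotientSheaf.cls_eq_zero (pullTangent f c) (U := .zero) hv)
      (SubquotientSheaf.cls_eq_zero (pullTangent f c) (U := .one) hv')
  rw [hq]
  constructor
  · rintro ⟨⟨a, ha, hac⟩, b, hb, hbc⟩
    obtain ⟨i, hi⟩ : ∃ i, vec c i ≠ 0 := by
      by_contra! h
      exact hc0 (vec_injective ((funext h).trans (map_zero (vecₗ d)).symm))
    have hab : a = b := mul_right_cancel₀ hi (congrFun (hac.trans hbc.symm) i)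
    subst hab
    obtain ⟨r, rfl⟩ := exists_dehom_binForm_eq ha hb
    refine ⟨r 0, vec_injective ?_⟩
    rw [← hac]
    funext i
    change dehom (binForm 0 r) * vec c i = vecₗ d (r 0 • c) i
    rw [map_smul, dehom_binForm]
    simp [vecₗ]
  · rintro ⟨r, hr⟩
    have h1 : scale (vec c) (algebraMap ℂ _ r) = vec (α : M d) := by
      rw [hr]
      funext i
      change algebraMap ℂ _ r * vec c i = vecₗ d (r • c) i
      rw [map_smul, Pi.smul_apply, Algebra.smul_def]
      rfl
    have h2 : ∀ U, algebraMap ℂ ℂ[T;T⁻¹] r ∈ twist 0 U := fun U => by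
      have := dehom_mem_twist (isHomogeneous_C (Fin 2) r) U
      rwa [dehom, ← algebraMap_eq, AlgHom.commutes] at this
    exact ⟨⟨_, h2 _, h1⟩, _, h2 _, h1⟩

theorem inducedSection_surjective {d : ℕ} {f : MvPolynomial (Fin 5) ℂ} (hf : f.IsHomogeneous 5)
    {c : M d} (hc : pull c f = 0) : Function.Surjective (inducedSection hc) := by
  rintro ⟨⟨s₀, s₁⟩, hs⟩
  obtain ⟨w₀, hw₀, rfl⟩ := SubquotientSheaf.cls_surjective _ s₀
  obtain ⟨w₁, hw₁, rfl⟩ := SubquotientSheaf.cls_surjective _ s₁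
  have hs' := (SubquotientSheaf.mem_H0 _).1 hs
  rw [SubquotientSheaf.res_cls, SubquotientSheaf.res_cls, SubquotientSheaf.cls_eq_cls] at hs'
  obtain ⟨a, -, ha⟩ := hs'
  -- `H¹(𝒪) = 0`: the two sections can be changed by multiples of `c` so as to agree
  obtain ⟨a₀, ha₀, a₁, ha₁, rfl⟩ := exists_twist_sub 0 a
  have hw : w₀ - scale (vec c) a₀ = w₁ - scale (vec c) a₁ := by
    rw [map_sub] at ha
    rw [sub_eq_sub_iff_sub_eq_sub, ha]
  have h₀ := Submodule.sub_mem _ hw₀ (scale_vec_mem_kernelSections hf hc ha₀)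
  have h₁ := Submodule.sub_mem _ hw₁ (scale_vec_mem_kernelSections hf hc ha₁)
  obtain ⟨α, hα⟩ := exists_vec_eq h₀.1 (hw ▸ h₁.1)
  have hα' : dpull f c α = 0 := by
    refine eq_zero_of_dehom_eq_zero (dpull_isHomogeneous hf c α) ?_
    rw [dehom_dpull, hα]
    exact h₀.2
  refine ⟨⟨α, (mem_tangentI hc).2 hα'⟩, Subtype.ext (Prod.ext ?_ ?_)⟩
  · refine (SubquotientSheaf.cls_eq_cls _ _ _).2 ⟨-a₀, Submodule.neg_mem _ ha₀, ?_⟩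
    change scale (vec c) (-a₀) = vec α - w₀
    rw [hα, map_neg]
    abel
  · refine (SubquotientSheaf.cls_eq_cls _ _ _).2 ⟨-a₁, Submodule.neg_mem _ ha₁, ?_⟩
    change scale (vec c) (-a₁) = vec α - w₁
    rw [hα, hw, map_neg]
    abel

theorem exists_quotient_equiv_H0 {d : ℕ} {f : MvPolynomial (Fin 5) ℂ} (hf : f.IsHomogeneous 5)
    {c : M d} (hc : pull c f = 0) (hc0 : c ≠ 0) :
    ∃ ℓ : Submodule ℂ (tangentI f c), Module.finrank ℂ ℓ = 1 ∧
      ∃ φ : (tangentI f c ⧸ ℓ) ≃ₗ[ℂ] (pullTangent f c).H0,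
        ∀ α : tangentI f c, IsInducedSection f c α (φ (Submodule.Quotient.mk α)) := by
  refine ⟨LinearMap.ker (inducedSection hc), ?_,
    (inducedSection hc).quotKerEquivOfSurjective (inducedSection_surjective hf hc),
    fun α => isInducedSection_inducedSection hc α⟩
  have hmem : c ∈ tangentI f c := (mem_tangentI hc).2 (by rw [dpull_self hf, hc, smul_zero])
  have h1 : LinearMap.ker (inducedSection hc) = ℂ ∙ (⟨c, hmem⟩ : tangentI f c) := by
    ext α
    rw [LinearMap.mem_ker, inducedSection_eq_zero_iff hc hc0, Submodule.mem_span_singleton]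
    exact exists_congr fun r => ⟨fun h => Subtype.ext h.symm, fun h => (congrArg Subtype.val h).symm⟩
  rw [h1]
  exact finrank_span_singleton fun h => hc0 (congrArg Subtype.val h)

/-- If there is a `4`-dimensional space of first order deformations, then `df(c)` maps the
`5d + 5`-dimensional space `M d` onto the `5d + 1`-dimensional space of forms of degree `5d`. -/
theorem exists_dpull_eq {d : ℕ} {f : MvPolynomial (Fin 5) ℂ} (hf : f.IsHomogeneous 5) {c : M d}
    (hker : Module.finrank ℂ (LinearMap.ker (dpull f c)) = 4) (a : Fin (d * 4 + d + 1) → ℂ) :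
    ∃ α, dpull f c α = binForm (d * 4 + d) a := by
  let n := d * 4 + d
  let B : (Fin (n + 1) → ℂ) →ₗ[ℂ] ℂ[T;T⁻¹] :=
    { toFun := fun a => dehom (binForm n a)
      map_add' := fun a b => by simp [dehom_binForm, add_smul, Finset.sum_add_distrib]
      map_smul' := fun r a => by simp [dehom_binForm, mul_smul, Finset.smul_sum] }
  have hB : Function.Injective B := dehom_binForm_injective n
  have hle : LinearMap.range (dehom.toLinearMap ∘ₗ dpull f c) ≤ LinearMap.range B := by
    rintro _ ⟨α, rfl⟩
    obtain ⟨b, hb⟩ := exists_binForm_eq (dpull_isHomogeneous hf c α)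
    exact ⟨b, congrArg dehom hb⟩
  have hk : LinearMap.ker (dehom.toLinearMap ∘ₗ dpull f c) = LinearMap.ker (dpull f c) := by
    ext α
    exact ⟨fun h => eq_zero_of_dehom_eq_zero (dpull_isHomogeneous hf c α) h,
      fun h => by rw [LinearMap.mem_ker] at h; simp [h]⟩
  have h1 := LinearMap.finrank_range_add_finrank_ker (dehom.toLinearMap ∘ₗ dpull f c)
  rw [hk, hker, Module.finrank_fintype_fun_eq_card, Fintype.card_prod, Fintype.card_fin,
    Fintype.card_fin] at h1
  have h2 : Module.finrank ℂ (LinearMap.range B) = n + 1 := by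
    rw [LinearMap.finrank_range_of_inj hB, Module.finrank_fintype_fun_eq_card, Fintype.card_fin]
  have heq := Submodule.eq_of_le_of_finrank_le hle (by rw [h2]; omega)
  obtain ⟨α, hα⟩ : B a ∈ LinearMap.range (dehom.toLinearMap ∘ₗ dpull f c) :=
    heq ▸ LinearMap.mem_range_self B a
  refine ⟨α, sub_eq_zero.1 (eq_zero_of_dehom_eq_zero
    ((dpull_isHomogeneous hf c α).sub (binForm_isHomogeneous _ a)) ?_)⟩
  rw [map_sub, sub_eq_zero]
  exact hα

/-- `H¹(N) = 0` since already `H¹` of the kernel of `df(c) : 𝒪(d)^{⊕5} → 𝒪(5d)`, of which `N` is a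
quotient, vanishes: it embeds into the cokernel of `df(c)` on global sections. -/
theorem subsingleton_H1_normalSheaf {d : ℕ} {f : MvPolynomial (Fin 5) ℂ} (hf : f.IsHomogeneous 5)
    {c : M d} (hker : Module.finrank ℂ (LinearMap.ker (dpull f c)) = 4) :
    Subsingleton (normalSheaf f c).H1 := by
  rw [Submodule.Quotient.subsingleton_iff, eq_top_iff]
  rintro s -
  obtain ⟨⟨w, hw⟩, rfl⟩ := Submodule.Quotient.mk_surjective _ s
  choose w₀ hw₀ w₁ hw₁ hww using fun i => exists_twist_sub d (w i)
  have hP : ∀ (i : Fin 5) (U : Chart), dehom (pull c (pderiv i f)) ∈ twist (d * 4) U :=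
    fun i U => dehom_mem_twist (pull_isHomogeneous c (hf.pderiv (i := i))) U
  have he : ∑ i, dehom (pull c (pderiv i f)) * w₀ i = ∑ i, dehom (pull c (pderiv i f)) * w₁ i := by
    rw [← sub_eq_zero, ← Finset.sum_sub_distrib, ← hw.2]
    exact Finset.sum_congr rfl fun i _ => by rw [hww i]; ring
  -- the common value is a global section of `𝒪(5d)`, hence `df(c)` of a global section
  obtain ⟨a, ha⟩ := exists_dehom_binForm_eq
    (Submodule.sum_mem _ fun i _ => mul_mem_twist (hP i .zero) (hw₀ i))
    (he ▸ Submodule.sum_mem _ fun i _ => mul_mem_twist (hP i .one) (hw₁ i))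
  obtain ⟨α, hα⟩ := exists_dpull_eq hf hker a
  have hα' : ∑ i, dehom (pull c (pderiv i f)) * vec α i =
      ∑ i, dehom (pull c (pderiv i f)) * w₀ i := by
    rw [← dehom_dpull, hα, ha]
  have h₀ : w₀ - vec α ∈ kernelSections f c .zero := by
    refine ⟨fun i => Submodule.sub_mem _ (hw₀ i) (vec_mem_twist α i _), ?_⟩
    simp only [Pi.sub_apply, mul_sub, Finset.sum_sub_distrib, hα', sub_self]
  have h₁ : vec α - w₁ ∈ kernelSections f c .one := by
    refine ⟨fun i => Submodule.sub_mem _ (vec_mem_twist α i _) (hw₁ i), ?_⟩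
    simp only [Pi.sub_apply, mul_sub, Finset.sum_sub_distrib, hα', he, sub_self]
  have hsum : (normalSheaf f c).res .zero ((normalSheaf f c).cls .zero _ h₀) +
      (normalSheaf f c).res .one ((normalSheaf f c).cls .one _ h₁) =
      Submodule.Quotient.mk ⟨w, hw⟩ := by
    refine congrArg Submodule.Quotient.mk (Subtype.ext ?_)
    change (w₀ - vec α) + (vec α - w₁) = w
    funext i
    simp [hww i]
  rw [← hsum]
  exact Submodule.add_mem_sup (LinearMap.mem_range_self _ _) (LinearMap.mem_range_self _ _)

/-! ### Forms without a common zero, directional derivatives and immersions -/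

/-- A binary form that vanishes at `p` is divisible by the linear form `p₀ x₁ - p₁ x₀`. -/
theorem exists_eq_mul_of_eval_eq_zero {n : ℕ} {F : MvPolynomial (Fin 2) ℂ}
    (hF : F.IsHomogeneous (n + 1)) {p : Fin 2 → ℂ} (hp : p ≠ 0) (h : eval p F = 0) :
    ∃ G : MvPolynomial (Fin 2) ℂ, G.IsHomogeneous n ∧ F = (C (p 0) * X 1 - C (p 1) * X 0) * G := by
  set l : MvPolynomial (Fin 2) ℂ := C (p 0) * X 1 - C (p 1) * X 0 with hl
  have hlhom : l.IsHomogeneous 1 :=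
    ((isHomogeneous_X ℂ 1).C_mul _).sub ((isHomogeneous_X ℂ 0).C_mul _)
  obtain ⟨k, hk⟩ : ∃ k, p k ≠ 0 := by
    by_contra! h0
    exact hp (funext h0)
  -- modulo `l`, both variables are multiples of `X k`, with the coordinates of `p` as factors
  have hX : ∀ i, l ∣ C (p k) * X i - C (p i) * X k := by
    intro i
    fin_cases k <;> fin_cases i
    · simp
    · exact ⟨1, by simp [hl]⟩
    · exact ⟨-1, by simp [hl]⟩
    · simp
  have hmk : ∀ G : MvPolynomial (Fin 2) ℂ, Ideal.Quotient.mk (Ideal.span {l}) G =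
      aeval (fun i => Ideal.Quotient.mk (Ideal.span {l}) (X i)) G := by
    intro G
    have : (Ideal.Quotient.mkₐ ℂ (Ideal.span {l})) =
        aeval (fun i => Ideal.Quotient.mk (Ideal.span {l}) (X i)) := by
      ext i; simp
    exact DFunLike.congr_fun this G
  have hdvd : l ∣ F := by
    rw [← Ideal.mem_span_singleton, ← Ideal.Quotient.eq_zero_iff_mem]
    have h1 : (fun i => Ideal.Quotient.mk (Ideal.span {l}) (X i)) =
        Ideal.Quotient.mk (Ideal.span {l}) (X k) •
          fun i => algebraMap ℂ (MvPolynomial (Fin 2) ℂ ⧸ Ideal.span {l}) (p i / p k) := by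
      funext i
      rw [Pi.smul_apply, smul_eq_mul, IsScalarTower.algebraMap_apply ℂ (MvPolynomial (Fin 2) ℂ),
        Ideal.Quotient.algebraMap_eq, ← map_mul, Ideal.Quotient.eq, Ideal.mem_span_singleton,
        algebraMap_eq]
      have h2 := (hX i).mul_left (C (p k)⁻¹)
      have h3 : (C (p k)⁻¹ : MvPolynomial (Fin 2) ℂ) * C (p k) = 1 := by
        rw [← C_mul, inv_mul_cancel₀ hk, C_1]
      convert h2 using 1
      rw [mul_sub, ← mul_assoc, h3, div_eq_mul_inv, C_mul]
      ring
    have h4 : eval (fun i => p i / p k) F = 0 := by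
      have : (fun i => p i / p k) = (p k)⁻¹ • p := by
        funext i
        simp [div_eq_inv_mul]
      rw [this, eval_smul_of_isHomogeneous hF, h, mul_zero]
    rw [hmk, aeval_def, ← eval_map, h1,
      eval_smul_of_isHomogeneous (hF.map _), eval_map, ← aeval_def]
    have h5 : aeval (fun i => algebraMap ℂ (MvPolynomial (Fin 2) ℂ ⧸ Ideal.span {l}) (p i / p k)) F =
        algebraMap ℂ _ (aeval (fun i => p i / p k) F) := aeval_algebraMap_apply _ _ _
    have h6 : aeval (fun i => p i / p k) F = (0 : ℂ) := h4
    rw [h5, h6, map_zero, mul_zero]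
  obtain ⟨G, rfl⟩ := hdvd
  refine ⟨homogeneousComponent n G, homogeneousComponent_isHomogeneous n G, ?_⟩
  rw [← homogeneousComponent_eq_self hF]
  conv_lhs => rw [← sum_homogeneousComponent G]
  rw [Finset.mul_sum, map_sum]
  have h7 : ∀ i, homogeneousComponent (n + 1) (l * homogeneousComponent i G) =
      if i = n then l * homogeneousComponent n G else 0 := by
    intro i
    rw [homogeneousComponent_of_mem ((mem_homogeneousSubmodule _ _).2
      (hlhom.mul (homogeneousComponent_isHomogeneous i G)))]
    by_cases hi : i = n
    · subst hi; simp [add_comm]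
    · rw [if_neg (by omega), if_neg hi]
  simp only [h7, Finset.sum_ite_eq']
  split_ifs with h8
  · rfl
  · rw [homogeneousComponent_eq_zero, mul_zero]
    simpa using h8

/-- The polynomial `F(1, z)`. -/
def toPoly : MvPolynomial (Fin 2) ℂ →ₐ[ℂ] Polynomial ℂ := aeval ![1, Polynomial.X]

theorem toPoly_binForm (n : ℕ) (a : Fin (n + 1) → ℂ) :
    toPoly (binForm n a) = ∑ j : Fin (n + 1), Polynomial.monomial (j : ℕ) (a j) := by
  simp [binForm, toPoly, ← Polynomial.C_mul_X_pow_eq_monomial, Polynomial.C_eq_algebraMap]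

theorem coeff_toPoly_binForm (n : ℕ) (a : Fin (n + 1) → ℂ) (k : ℕ) :
    (toPoly (binForm n a)).coeff k = ∑ j : Fin (n + 1), if (j : ℕ) = k then a j else 0 := by
  simp [toPoly_binForm, Polynomial.coeff_monomial]

theorem natDegree_toPoly_le {n : ℕ} {F : MvPolynomial (Fin 2) ℂ} (hF : F.IsHomogeneous n) :
    (toPoly F).natDegree ≤ n := by
  obtain ⟨a, rfl⟩ := exists_binForm_eq hF
  rw [Polynomial.natDegree_le_iff_coeff_eq_zero]
  intro k hk
  rw [coeff_toPoly_binForm]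
  exact Finset.sum_eq_zero fun j _ => if_neg (by omega)

theorem eq_zero_of_toPoly_eq_zero {n : ℕ} {F : MvPolynomial (Fin 2) ℂ} (hF : F.IsHomogeneous n)
    (h : toPoly F = 0) : F = 0 := by
  obtain ⟨a, rfl⟩ := exists_binForm_eq hF
  have : a = 0 := by
    funext k
    have h1 := coeff_toPoly_binForm n a k
    rw [h] at h1
    simpa [Fin.val_inj] using h1.symm
  simp [this, binForm]

theorem coeff_toPoly_eq_eval {n : ℕ} {F : MvPolynomial (Fin 2) ℂ} (hF : F.IsHomogeneous n) :
    (toPoly F).coeff n = eval ![0, 1] F := by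
  obtain ⟨a, rfl⟩ := exists_binForm_eq hF
  rw [coeff_toPoly_binForm]
  simp only [binForm, map_sum, map_mul, eval_C, map_pow, eval_X]
  refine Finset.sum_congr rfl fun j _ => ?_
  have := j.2
  by_cases hj : (j : ℕ) = n
  · simp [hj]
  · have h1 : n - (j : ℕ) ≠ 0 := by omega
    simp [hj, h1]

theorem eval_toPoly (z : ℂ) (F : MvPolynomial (Fin 2) ℂ) :
    (toPoly F).eval z = eval ![1, z] F := by
  have : (Polynomial.aeval z).comp toPoly = (aeval ![1, z] : MvPolynomial (Fin 2) ℂ →ₐ[ℂ] ℂ) := by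
    ext i
    fin_cases i <;> simp [toPoly]
  exact DFunLike.congr_fun this F

/-- Forms of degree `d` without common zero are coprime, so a tuple proportional to them has at
least their degree or vanishes. -/
theorem eq_zero_of_mul_eq_mul {d e : ℕ} {c : M d} (hc : IsBasePointFree c) (he : e < d)
    {g : Fin 5 → MvPolynomial (Fin 2) ℂ} (hg : ∀ i, (g i).IsHomogeneous e)
    (h : ∀ i j, form c i * g j = form c j * g i) : g = 0 := by
  have htop : Ideal.span (Set.range fun i => toPoly (form c i)) = ⊤ := by
    obtain ⟨r, hr⟩ := IsPrincipalIdealRing.principal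
      (Ideal.span (Set.range fun i => toPoly (form c i)))
    have hr' : Ideal.span (Set.range fun i => toPoly (form c i)) = Ideal.span {r} := hr
    rw [hr', Ideal.span_singleton_eq_top]
    by_contra hu
    obtain ⟨z, hz⟩ : ∃ z, r.IsRoot z := by
      by_cases h0 : r.degree = 0
      · exact absurd (Polynomial.isUnit_iff_degree_eq_zero.2 h0) hu
      · exact IsAlgClosed.exists_root r h0
    obtain ⟨i, hi⟩ := hc ![1, z] (fun e => one_ne_zero (congrFun e 0))
    refine hi ?_
    rw [← eval_toPoly]
    have h1 : toPoly (form c i) ∈ Ideal.span {r} := hr' ▸ Ideal.subset_span ⟨i, rfl⟩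
    exact Polynomial.eval_eq_zero_of_dvd_of_eval_eq_zero (Ideal.mem_span_singleton.1 h1) hz
  obtain ⟨a, ha⟩ := (Ideal.mem_span_range_iff_exists_fun).1
    ((Ideal.eq_top_iff_one _).1 htop)
  have hG : ∀ j, toPoly (g j) = (∑ i, a i * toPoly (g i)) * toPoly (form c j) := by
    intro j
    calc toPoly (g j) = (∑ i, a i * toPoly (form c i)) * toPoly (g j) := by rw [ha, one_mul]
      _ = _ := by
        rw [Finset.sum_mul, Finset.sum_mul]
        refine Finset.sum_congr rfl fun i _ => ?_
        rw [mul_assoc, ← map_mul, h, map_mul]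
        ring
  have hsum : (∑ i, a i * toPoly (g i)) = 0 := by
    obtain ⟨j, hj⟩ := hc ![0, 1] (fun e => one_ne_zero (congrFun e 1))
    rw [← coeff_toPoly_eq_eval (form_isHomogeneous c j)] at hj
    by_contra h0
    have h1 : toPoly (form c j) ≠ 0 := fun h => hj (by rw [h, Polynomial.coeff_zero])
    have h2 := natDegree_toPoly_le (hg j)
    rw [hG j, Polynomial.natDegree_mul h0 h1] at h2
    have h3 := Polynomial.le_natDegree_of_ne_zero hj
    omega
  funext j
  exact eq_zero_of_toPoly_eq_zero (hg j) (by rw [hG j, hsum, zero_mul])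

theorem sum_pull_mul_pderiv_form {d : ℕ} {f : MvPolynomial (Fin 5) ℂ} {c : M d}
    (hc : pull c f = 0) (k : Fin 2) :
    ∑ i, pull c (pderiv i f) * pderiv k (form c i) = 0 := by
  have h := (pderiv k : Derivation ℂ (MvPolynomial (Fin 2) ℂ) _).apply_aeval (form c) f
  rw [← pull, hc, map_zero] at h
  exact h.symm

/-- The derivative `∂_w c` of the forms `c` in the direction of the vector `w`. -/
def dirDeriv {d : ℕ} (c : M d) (w : Fin 2 → ℂ) (i : Fin 5) : MvPolynomial (Fin 2) ℂ :=
  C (w 0) * pderiv 0 (form c i) + C (w 1) * pderiv 1 (form c i)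

theorem dirDeriv_isHomogeneous {d : ℕ} (c : M d) (w : Fin 2 → ℂ) (i : Fin 5) :
    (dirDeriv c w i).IsHomogeneous (d - 1) :=
  ((form_isHomogeneous c i).pderiv.C_mul _).add ((form_isHomogeneous c i).pderiv.C_mul _)

theorem eval_dirDeriv_self {d : ℕ} (c : M d) (p : Fin 2 → ℂ) (i : Fin 5) :
    eval p (dirDeriv c p i) = d * eval p (form c i) := by
  have h := congrArg (eval p) (form_isHomogeneous c i).sum_X_mul_pderiv
  simpa [dirDeriv, Fin.sum_univ_two] using h

theorem sum_pull_mul_dirDeriv {d : ℕ} {f : MvPolynomial (Fin 5) ℂ} {c : M d}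
    (hc : pull c f = 0) (w : Fin 2 → ℂ) :
    ∑ i, pull c (pderiv i f) * dirDeriv c w i = 0 := by
  simp only [dirDeriv, mul_add, Finset.sum_add_distrib, mul_left_comm _ (C _), ← Finset.mul_sum,
    sum_pull_mul_pderiv_form hc, mul_zero, add_zero]

/-- Euler's identity in the coordinates given by two vectors `p`, `w`. -/
theorem euler_dirDeriv {d : ℕ} (c : M d) (p w : Fin 2 → ℂ) (i : Fin 5) :
    (C (w 1) * X 0 - C (w 0) * X 1) * dirDeriv c p i +
      (C (p 0) * X 1 - C (p 1) * X 0) * dirDeriv c w i =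
      C ((p 0 * w 1 - p 1 * w 0) * d) * form c i := by
  have h := (form_isHomogeneous c i).sum_X_mul_pderiv
  rw [Fin.sum_univ_two, nsmul_eq_mul] at h
  have hd : (C (d : ℂ) : MvPolynomial (Fin 2) ℂ) = (d : MvPolynomial (Fin 2) ℂ) := by simp
  simp only [dirDeriv, C_mul, C_sub, hd]
  linear_combination (C (p 0) * C (w 1) - C (p 1) * C (w 0)) * h

theorem mem_span_of_det_eq_zero {p w : Fin 2 → ℂ} (hp : p ≠ 0) (h : p 0 * w 1 - p 1 * w 0 = 0) :
    w ∈ Submodule.span ℂ {p} := by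
  rw [Submodule.mem_span_singleton]
  by_cases h0 : p 0 = 0
  · have h1 : p 1 ≠ 0 := fun h1 => hp (funext fun i => by fin_cases i <;> assumption)
    have h2 : w 0 = 0 := by
      rw [h0, zero_mul, zero_sub, neg_eq_zero] at h
      exact (mul_eq_zero.1 h).resolve_left h1
    refine ⟨w 1 / p 1, funext fun i => ?_⟩
    fin_cases i
    · simp [h0, h2]
    · simp [h1]
  · refine ⟨w 0 / p 0, funext fun i => ?_⟩
    fin_cases i
    · simp [h0]
    · simp
      field_simp
      linear_combination -h

/-- `binForm` as a linear map. -/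
def binFormₗ (n : ℕ) : (Fin (n + 1) → ℂ) →ₗ[ℂ] MvPolynomial (Fin 2) ℂ where
  toFun := binForm n
  map_add' a b := by simp [binForm, add_mul, Finset.sum_add_distrib]
  map_smul' r a := by
    simp only [binForm, Pi.smul_apply, smul_eq_mul, C_mul, RingHom.id_apply, smul_eq_C_mul,
      Finset.mul_sum, mul_assoc]

theorem binForm_injective (n : ℕ) : Function.Injective (binForm n) := fun _ _ h =>
  dehom_binForm_injective n (congrArg dehom h)

/-- If the differential of `c` kills the direction `w` at `p`, then `∂_w c = l g` for a linear form
`l`, and the tuples `A g + B ∂_p c`, for quadratic `A` and linear `B`, are a `5`-dimensional space of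
first order deformations. -/
theorem five_le_finrank_ker_dpull {e : ℕ} {f : MvPolynomial (Fin 5) ℂ} {c : M (e + 2)}
    (hc : pull c f = 0) (hbpf : IsBasePointFree c) {p w : Fin 2 → ℂ} (hp : p ≠ 0)
    (hw : w ∉ Submodule.span ℂ {p}) (h : ∀ i, eval p (dirDeriv c w i) = 0) :
    5 ≤ Module.finrank ℂ (LinearMap.ker (dpull f c)) := by
  have hδ : p 0 * w 1 - p 1 * w 0 ≠ 0 := fun h0 => hw (mem_span_of_det_eq_zero hp h0)
  choose g hg hug using fun i =>
    exists_eq_mul_of_eval_eq_zero (dirDeriv_isHomogeneous c w i) hp (h i)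
  have hl : (C (p 0) * X 1 - C (p 1) * X 0 : MvPolynomial (Fin 2) ℂ) ≠ 0 := by
    intro h0
    have h1 := congrArg (eval w) h0
    simp only [map_sub, map_mul, eval_C, eval_X, map_zero] at h1
    exact hδ h1
  have hg0 : g ≠ 0 := by
    intro h0
    have hw0 : w ≠ 0 := fun h1 => hw (h1 ▸ Submodule.zero_mem _)
    obtain ⟨i, hi⟩ := hbpf w hw0
    have h1 := eval_dirDeriv_self c w i
    rw [hug i, h0, Pi.zero_apply, mul_zero, map_zero] at h1
    exact hi ((mul_eq_zero.1 h1.symm).resolve_left (Nat.cast_ne_zero.2 (by omega)))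
  have hPg : ∑ i, pull c (pderiv i f) * g i = 0 := by
    refine (mul_eq_zero.1 ?_).resolve_left hl
    rw [Finset.mul_sum, ← sum_pull_mul_dirDeriv hc w]
    exact Finset.sum_congr rfl fun i _ => by rw [hug]; ring
  let N : ((Fin 3 → ℂ) × (Fin 2 → ℂ)) →ₗ[ℂ] (Fin 5 → MvPolynomial (Fin 2) ℂ) :=
    LinearMap.pi fun i =>
      ((LinearMap.mulRight ℂ (g i)) ∘ₗ binFormₗ 2).coprod
        ((LinearMap.mulRight ℂ (dirDeriv c p i)) ∘ₗ binFormₗ 1)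
  have hN : ∀ x i, N x i = binForm 2 x.1 * g i + binForm 1 x.2 * dirDeriv c p i := fun _ _ => rfl
  have hinj : Function.Injective N := by
    rw [injective_iff_map_eq_zero]
    rintro ⟨a, b⟩ hab
    have h1 : ∀ i, binForm 2 a * g i + binForm 1 b * dirDeriv c p i = 0 := fun i => by
      rw [← hN (a, b) i, hab, Pi.zero_apply]
    have hB : binForm 1 b = 0 := by
      by_contra hB
      refine hg0 (eq_zero_of_mul_eq_mul hbpf (by omega) hg fun i j => ?_)
      set D : MvPolynomial (Fin 2) ℂ := C ((p 0 * w 1 - p 1 * w 0) * ((e + 2 : ℕ) : ℂ)) with hD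
      have hD0 : D * binForm 1 b ≠ 0 := by
        refine mul_ne_zero ?_ hB
        rw [hD, Ne, C_eq_zero]
        exact mul_ne_zero hδ (Nat.cast_ne_zero.2 (by omega))
      -- Euler's identity eliminates `∂_p c`, so that `g` is proportional to `c`
      have h2 : ∀ i, D * binForm 1 b * form c i =
          ((C (p 0) * X 1 - C (p 1) * X 0) ^ 2 * binForm 1 b -
            (C (w 1) * X 0 - C (w 0) * X 1) * binForm 2 a) * g i := fun i => by
        have h3 := euler_dirDeriv c p w i
        rw [hug i] at h3
        linear_combination (C (w 1) * X 0 - C (w 0) * X 1) * h1 i - binForm 1 b * h3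
      refine mul_left_cancel₀ hD0 ?_
      linear_combination h2 i * g j - h2 j * g i
    have hA : binForm 2 a = 0 := by
      obtain ⟨i, hi⟩ := Function.ne_iff.1 hg0
      have h2 := h1 i
      rw [hB, zero_mul, add_zero] at h2
      exact (mul_eq_zero.1 h2).resolve_right hi
    exact Prod.ext (binForm_injective 2 (hA.trans (map_zero (binFormₗ 2)).symm))
      (binForm_injective 1 (hB.trans (map_zero (binFormₗ 1)).symm))
  let Fm : M (e + 2) →ₗ[ℂ] (Fin 5 → MvPolynomial (Fin 2) ℂ) :=
    LinearMap.pi fun i => binFormₗ (e + 2) ∘ₗ LinearMap.funLeft ℂ ℂ fun j => (i, j)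
  have hFm : ∀ α i, Fm α i = form α i := fun _ _ => rfl
  have hle : LinearMap.range N ≤ (LinearMap.ker (dpull f c)).map Fm := by
    rintro _ ⟨x, rfl⟩
    have h1 : ∀ i, (N x i).IsHomogeneous (e + 2) := fun i => by
      rw [hN]
      refine IsHomogeneous.add ?_ ?_
      · have := (binForm_isHomogeneous 2 x.1).mul (hg i)
        rwa [add_comm] at this
      · have := (binForm_isHomogeneous 1 x.2).mul (dirDeriv_isHomogeneous c p i)
        rwa [show 1 + (e + 2 - 1) = e + 2 by omega] at this
    choose α hα using fun i => exists_binForm_eq (h1 i)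
    have h2 : Fm (fun k => α k.1 k.2) = N x := funext hα
    refine ⟨_, ?_, h2⟩
    rw [SetLike.mem_coe, LinearMap.mem_ker, dpull_apply]
    simp only [← hFm, h2, hN, mul_add, Finset.sum_add_distrib, mul_left_comm _ (binForm _ _),
      ← Finset.mul_sum, hPg, sum_pull_mul_dirDeriv hc, mul_zero, add_zero]
  calc 5 = Module.finrank ℂ (LinearMap.range N) := by
        rw [LinearMap.finrank_range_of_inj hinj, Module.finrank_prod,
          Module.finrank_fintype_fun_eq_card, Module.finrank_fintype_fun_eq_card]
        simp
    _ ≤ Module.finrank ℂ ((LinearMap.ker (dpull f c)).map Fm) := Submodule.finrank_mono hle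
    _ ≤ _ := Submodule.finrank_map_le _ _

/-- A curve with only a `4`-dimensional space of first order deformations is an immersion. -/
theorem isImmersion_of_finrank_ker_dpull {d : ℕ} {f : MvPolynomial (Fin 5) ℂ} {c : M d}
    (hd : d ≠ 0) (hc : pull c f = 0) (hcd : c ∈ Md d)
    (hker : Module.finrank ℂ (LinearMap.ker (dpull f c)) = 4) : IsImmersion c := by
  refine ⟨fun p hp w hw => ?_, hcd.2⟩
  by_contra hwp
  obtain ⟨r, hr⟩ := Submodule.mem_span_singleton.1 hw
  have hd' : (d : ℂ) ≠ 0 := Nat.cast_ne_zero.2 hd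
  -- by Euler's identity a multiple of `p` can be subtracted from `w` to make the derivative zero
  set v := w - (r / d) • p with hv
  have hvp : v ∉ Submodule.span ℂ {p} := fun h => hwp (by
    have := Submodule.add_mem _ h
      (Submodule.smul_mem _ (r / d) (Submodule.mem_span_singleton_self p))
    rwa [hv, sub_add_cancel] at this)
  have hzero : ∀ i, eval p (dirDeriv c v i) = 0 := by
    intro i
    have h1 : eval p (dirDeriv c w i) = r * eval p (form c i) := by
      have := congrFun hr i
      simp only [Pi.smul_apply, smul_eq_mul, Fin.sum_univ_two] at this
      rw [this]
      simp [dirDeriv, mul_comm]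
    have h2 : eval p (dirDeriv c v i) =
        eval p (dirDeriv c w i) - r / d * eval p (dirDeriv c p i) := by
      simp only [dirDeriv, hv, map_add, map_mul, eval_C, Pi.sub_apply, Pi.smul_apply, smul_eq_mul]
      ring
    rw [h2, h1, eval_dirDeriv_self]
    field_simp
    ring
  obtain _ | _ | e := d
  · exact hd rfl
  · -- for `d = 1` the derivatives are constants, so Euler's identity makes `v` a base point
    have hv0 : v ≠ 0 := fun h1 => hvp (h1 ▸ Submodule.zero_mem _)
    obtain ⟨i, hi⟩ := hcd.1 v hv0
    have h1 := eval_dirDeriv_self c v i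
    obtain ⟨a, ha⟩ := exists_binForm_eq (dirDeriv_isHomogeneous c v i)
    have h2 : ∀ x : Fin 2 → ℂ, eval x (dirDeriv c v i) = a 0 := fun x => by
      rw [← ha]; simp [binForm]
    rw [h2, ← h2 p, hzero i] at h1
    exact hi ((mul_eq_zero.1 h1.symm).resolve_left hd')
  · exact absurd ((five_le_finrank_ker_dpull hc hcd.1 hp hvp hzero).trans_eq hker) (by norm_num)

theorem ne_zero_of_isBasePointFree {d : ℕ} {c : M d} (hc : IsBasePointFree c) : c ≠ 0 := by
  rintro rfl
  obtain ⟨i, hi⟩ := hc ![1, 0] (fun e => one_ne_zero (congrFun e 0))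
  exact hi (by simp [form])

theorem degree_ne_zero_of_isBirationalOntoImage {d : ℕ} {c : M d}
    (hc : IsBirationalOntoImage c) : d ≠ 0 := by
  rintro rfl
  obtain ⟨e, G, hG, ⟨k, hk⟩, h⟩ := hc
  have h1 : ∀ k, ∃ r : ℂ, pull c (G k) = C r := fun k => by
    have h2 := pull_isHomogeneous c (hG k)
    rw [zero_mul] at h2
    exact ⟨_, (totalDegree_eq_zero_iff_eq_C.1 (Nat.le_zero.1 h2.totalDegree_le))⟩
  choose r hr using h1
  rw [hr, hr] at h
  have h2 := congrArg (eval ![0, 1]) h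
  have h3 := congrArg (eval ![1, 0]) h
  simp at h2 h3
  refine hk ?_
  rw [hr]
  fin_cases k
  · simp [h2]
  · simp [← h3]

end QuinticCurves

end

open QuinticCurves in
theorem lemma2p2 (d : ℕ) :
    ForGenericQuintic fun f₀ =>
      ∀ f₂ : MvPolynomial (Fin 5) ℂ, f₂.IsHomogeneous 5 → LinearIndependent ℂ ![f₀, f₂] →
      ∀ L₂ : Set (ℙ ℂ (Fin 2 → ℂ)), IsOpen (cone L₂) → basePt ∈ L₂ →
      ∀ (I : Set (M d)) (Γ : Set (M d × (Fin 2 → ℂ))),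
        IsIrredComponent (algebraicSubsets (incidence d f₀)) I →
        IsIrredComponent (analyticSubsets (incidenceOver d f₀ f₂ L₂)) Γ →
        I ⊆ Prod.fst '' Γ →
        ForGenericPoint I (fun c₀ => pull c₀ f₂ ≠ 0) →
        ForGenericPoint I fun c₀ =>
          -- (a)
          (∃ ℓ : Submodule ℂ (tangentI f₀ c₀), Module.finrank ℂ ℓ = 1 ∧
            ∃ φ : (tangentI f₀ c₀ ⧸ ℓ) ≃ₗ[ℂ] (pullTangent f₀ c₀).H0,
              ∀ α : tangentI f₀ c₀,
                IsInducedSection f₀ c₀ α (φ (Submodule.Quotient.mk α))) ∧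
          -- (b)
          (Module.finrank ℂ (tangentGammaPencil f₀ f₂ c₀) =
              Module.finrank ℂ (tangentI f₀ c₀) + 1 ∧
            Module.finrank ℂ (tangentIPencil f₀ f₂ c₀) =
              Module.finrank ℂ (tangentI f₀ c₀) + 1) ∧
          -- (c)
          (Module.finrank ℂ (tangentIPencil f₀ f₂ c₀) = 5 →
            IsImmersion c₀ ∧ Subsingleton (normalSheaf f₀ c₀).H1) := by
  obtain ⟨n, Q, hQhom, hQ, H⟩ := forGenericQuintic_deformsWith d
  refine ⟨n, Q, hQhom, hQ, fun f₀ hf₀ hf₀0 hf₀Q f₂ hf₂ _ L₂ _ _ I Γ hI _ _ hgen => ?_⟩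
  have hdef := H f₀ hf₀ hf₀0 hf₀Q
  obtain ⟨q, hq, hgen⟩ := hgen
  refine ⟨q, hq, fun c hcI hcq => ?_⟩
  obtain ⟨⟨P, rfl⟩, -⟩ := hI.prop
  obtain ⟨hcd, hc⟩ : c ∈ incidence d f₀ := hcI.1
  have h₂ := hgen c hcI hcq
  have hb := finrank_tangentIPencil hc h₂ (hdef c hc f₂ hf₂)
  refine ⟨exists_quotient_equiv_H0 hf₀ hc (ne_zero_of_isBasePointFree hcd.1),
    ⟨(finrank_tangentGammaPencil hc h₂).trans hb, hb⟩, fun h5 => ?_⟩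
  have hker : Module.finrank ℂ (LinearMap.ker (dpull f₀ c)) = 4 := by
    have : tangentI f₀ c = LinearMap.ker (dpull f₀ c) :=
      Submodule.ext fun α => mem_tangentI hc
    rw [← this]
    omega
  exact ⟨isImmersion_of_finrank_ker_dpull
    (degree_ne_zero_of_isBirationalOntoImage hcd.2) hc hcd hker,
    subsingleton_H1_normalSheaf hf₀ hker⟩
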